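/- Let $H$ be a separable real Hilbert space, $T>0$, $I=[0,T]$, and $\mathbb B$ the closed unit ball. For a locally Lipschitz $f\colon H\to\mathbb R$ let $\partial f$ be the Clarke subdifferential, for $S\subset H$ let $d_S=d(\cdot,S)$ be the distance function and $N(S;x)$ the Clarke normal cone ($\emptyset$ if $x\notin S$). Let $\mathcal A\colon H\to H$ satisfy, for some $m,M>0$ and all $x,y\in H$, $\langle \mathcal A(x)-\mathcal A(y),x-y\rangle\ge m\|x-y\|^2$ and $\|\mathcal A(x)-\mathcal A(y)\|\le M\|x-y\|$. Let $C\colon I\times H\rightrightarrows H$ have nonempty closed values and satisfy: (1) there are $L\in[0,m[$ and, for every $r\ge 0$, a $\kappa_r\ge 0$ with $\sup_{z\in r\mathbb B}|d(z,C(t,x))-d(z,C(s,y))|\le \kappa_r|t-s|+L\|x-y\|$ for all $s,t\in I$, $x,y\in H$; (2) the family $\{C(t,v)\}_{(t,v)\in I\times H}$ is equi-uniformly subsmooth: for every $\varepsilon>0$ there is $\delta>0$ such that $\langle w_1-w_2,x_1-x_2\rangle\ge-\varepsilon\|x_1-x_2\|$ for all $(t,v)\in I\times H$, all $x_1,x_2\in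 C(t,v)$ with $\|x_1-x_2\|<\delta$ and all $w_i\in N(C(t,v);x_i)\cap\mathbb B$; (3) there is $k\in L^1(0,T)$ with $k(t)<1$ for all $t\in I$ such that $\gamma(C(t,B)\cap r\mathbb B)\le k(t)\,\gamma(\mathcal A(B))$ for all $t\in I$, $r>0$ and bounded $B\subset H$, where $C(t,B)=\bigcup_{x\in B}C(t,x)$ and $\gamma$ is either the Kuratowski or the Hausdorff measure of non-compactness. Let $x_0\in H$ with $\mathcal A(x_0)\in C(0,x_0)$. For $\alpha\in]0,1]$ and $\rho\in]0,+\infty]$, let $\mathrm{Far}(\alpha,\rho)$ be the property that for every $y\in H$ and a.e. $t\in I$, $d\big(0,\partial d_{C(t,y)}(x)\big)\ge\alpha$ for all $x$ with $0<d(x,C(t,y))<\rho$. For $\lambda>0$, a solution of $(P_\lambda)$ is an absolutely continuous $x_\lambda\colon I\to H$ with $x_\lambda(0)=x_0$ and $$-\dot x_\lambda(t)\in\frac1{2\lambda}\,\partial d^2_{C(t,x_\lambda(t))}\big(\mathcal A(x_\lambda(t))\big)\quad\text{for a.e. }t\in I,$$ and $\varphi_\lambda(t):=d(\mathcal A(x_\lambda(t)),C(t,x_\lambda(t)))$.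 Then for every $\alpha\in\,]\sqrt{L/m},1[$ there is $\rho>0$ such that $\mathrm{Far}(\alpha,\rho)$ holds. Moreover, let $\alpha\in\,]\sqrt{L/m},1]$ and $\rho\in]0,+\infty]$ be such that $\mathrm{Far}(\alpha,\rho)$ holds, let $R>0$ and put $\tilde\kappa:=\kappa_{\|\mathcal A(x_0)\|+MR}$. Then there is $\tau_R\in\,]0,T]$, independent of $\lambda$, such that for every $\lambda>0$ with $\lambda<\frac{m\alpha^2-L}{\tilde\kappa}\rho$ (every $\lambda>0$ if $\tilde\kappa=0$ or $\rho=+\infty$) and every solution $x_\lambda$ of $(P_\lambda)$: (a) $\varphi_\lambda$ is differentiable with $\dot\varphi_\lambda(t)\le\tilde\kappa+\frac{L-m\alpha^2}{\lambda}\varphi_\lambda(t)$ for a.e. $t\in[0,\tau_R]$; (b) $\varphi_\lambda(t)\le\frac{\tilde\kappa\lambda}{m\alpha^2-L}$ for all $t\in[0,\tau_R]$; (c) $x_\lambda$ is $\frac{\tilde\kappa}{m\alpha^2-L}$-Lipschitz on $[0,\tau_R]$. -/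

import Mathlib

open Set Filter Topology MeasureTheory
open scoped Pointwise ENNReal NNReal

namespace Sweeping

noncomputable section

variable {H : Type*} [NormedAddCommGroup H] [InnerProductSpace ℝ H]

/-- The Clarke tangent cone of `S` at `x`. -/
def clarkeTangentCone (S : Set H) (x : H) : Set H :=
  {h | ∀ (u : ℕ → H) (t : ℕ → ℝ), (∀ n, u n ∈ S) → Tendsto u atTop (𝓝 x) →
    (∀ n, 0 < t n) → Tendsto t atTop (𝓝 0) →
    ∃ g : ℕ → H, Tendsto g atTop (𝓝 h) ∧ ∀ n, u n + t n • g n ∈ S}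

/-- The Clarke normal cone of `S` at `x`: the negative polar of the Clarke tangent cone if `x ∈ S`,
and empty if `x ∉ S`. -/
def clarkeNormalCone (S : Set H) (x : H) : Set H :=
  {v | x ∈ S ∧ ∀ h ∈ clarkeTangentCone S x, inner ℝ v h ≤ 0}

/-- Clarke's generalized directional derivative `f°(x; h)`, the upper limit of
`(f (y + s h) - f y) / s` as `s ↓ 0` and `y → x`. -/
def clarkeDeriv (f : H → ℝ) (x h : H) : EReal :=
  limsup (fun p : ℝ × H => (((f (p.2 + p.1 • h) - f p.2) / p.1 : ℝ) : EReal))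
    (𝓝[>] (0 : ℝ) ×ˢ 𝓝 x)

/-- The Clarke subdifferential of a locally Lipschitz function `f` at `x`. -/
def clarkeSubdiff (f : H → ℝ) (x : H) : Set H :=
  {v | ∀ h : H, ((inner ℝ v h : ℝ) : EReal) ≤ clarkeDeriv f x h}

/-- `A` is strongly monotone with constant `m`. -/
def StronglyMonotone (A : H → H) (m : ℝ) : Prop :=
  ∀ x y, m * ‖x - y‖ ^ 2 ≤ inner ℝ (A x - A y) (x - y)

/-- `A` is Lipschitz with constant `M`. -/
def LipschitzMap (A : H → H) (M : ℝ) : Prop :=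
  ∀ x y, ‖A x - A y‖ ≤ M * ‖x - y‖

/-- The moving set `C`, on `[0,T] × H`, is Lipschitz for the truncated Hausdorff distances: for each
`r ≥ 0`, the supremum over `‖z‖ ≤ r` of `|d(z, C(t,x)) - d(z, C(s,y))|` is at most
`κ r * |t - s| + L * ‖x - y‖`. -/
def TruncatedLipschitz (C : ℝ → H → Set H) (T : ℝ) (κ : ℝ → ℝ) (L : ℝ) : Prop :=
  ∀ r, 0 ≤ r → 0 ≤ κ r ∧
    ∀ s ∈ Icc 0 T, ∀ t ∈ Icc 0 T, ∀ x y z : H, ‖z‖ ≤ r →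
      |Metric.infDist z (C t x) - Metric.infDist z (C s y)| ≤ κ r * |t - s| + L * ‖x - y‖

/-- For every `y` and almost every `t ∈ [0,T]`, the Clarke subdifferential of the distance function
to `C(t,y)` stays at distance at least `α` from the origin on the open tube of radius `ρ` around
`C(t,y)`. -/
def PositivelyFar (C : ℝ → H → Set H) (T α : ℝ) (ρ : ℝ≥0∞) : Prop :=
  ∀ y : H, ∀ᵐ t ∂(volume.restrict (Icc 0 T)), ∀ x : H,
    0 < Metric.infDist x (C t y) → ENNReal.ofReal (Metric.infDist x (C t y)) < ρ →
      α ≤ Metric.infDist 0 (clarkeSubdiff (fun z => Metric.infDist z (C t y)) x)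

/-- The family `(C(t,v))`, `(t,v) ∈ [0,T] × H`, is equi-uniformly subsmooth. -/
def EquiUniformlySubsmooth (C : ℝ → H → Set H) (T : ℝ) : Prop :=
  ∀ ε > 0, ∃ δ > 0, ∀ t ∈ Icc 0 T, ∀ v : H, ∀ x₁ ∈ C t v, ∀ x₂ ∈ C t v, ‖x₁ - x₂‖ < δ →
    ∀ w₁ ∈ clarkeNormalCone (C t v) x₁, ∀ w₂ ∈ clarkeNormalCone (C t v) x₂,
      ‖w₁‖ ≤ 1 → ‖w₂‖ ≤ 1 → -ε * ‖x₁ - x₂‖ ≤ inner ℝ (w₁ - w₂) (x₁ - x₂)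

/-- Kuratowski measure of non-compactness of a bounded set. -/
def kuratowskiMeasure (B : Set H) : ℝ :=
  sInf {d : ℝ | 0 < d ∧ ∃ F : Set (Set H), F.Finite ∧ B ⊆ ⋃₀ F ∧
    ∀ S ∈ F, Metric.ediam S ≤ ENNReal.ofReal d}

/-- Hausdorff (ball) measure of non-compactness of a bounded set. -/
def hausdorffMeasure (B : Set H) : ℝ :=
  sInf {r : ℝ | 0 < r ∧ ∃ F : Set H, F.Finite ∧ B ⊆ ⋃ c ∈ F, Metric.closedBall c r}

/-- The compactness condition on `C`, for a measure of non-compactness `γ`: for some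
`k ∈ L¹(0,T)` with `k < 1`, and for all `t ∈ [0,T]`, `r > 0` and bounded `B`,
`γ (C(t,B) ∩ r𝔹) ≤ k(t) γ(A(B))`. -/
def CompactnessCondition (γ : Set H → ℝ) (A : H → H) (C : ℝ → H → Set H) (T : ℝ) : Prop :=
  ∃ k : ℝ → ℝ, IntegrableOn k (Ioo 0 T) ∧ (∀ t ∈ Icc 0 T, k t < 1) ∧
    ∀ t ∈ Icc 0 T, ∀ r > 0, ∀ B : Set H, Bornology.IsBounded B →
      γ ((⋃ x ∈ B, C t x) ∩ Metric.closedBall 0 r) ≤ k t * γ (A '' B)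

/-- `x` is an absolutely continuous solution on `[0,T]` of the regularized problem with parameter
`lam`: `-x'(t) ∈ (1 / (2 lam)) ∂ d²(·, C(t, x(t))) (A (x(t)))` for a.e. `t`, and `x(0) = x₀`. -/
structure IsRegularizedSolution (A : H → H) (C : ℝ → H → Set H) (T : ℝ) (x₀ : H) (lam : ℝ)
    (x : ℝ → H) : Prop where
  absCont : AbsolutelyContinuousOnInterval x 0 T
  initial : x 0 = x₀
  inclusion : ∀ᵐ t ∂(volume.restrict (Icc 0 T)), DifferentiableAt ℝ x t ∧
    -deriv x t ∈
      (1 / (2 * lam)) • clarkeSubdiff (fun z => Metric.infDist z (C t (x t)) ^ 2) (A (x t))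

/-- `φ(t) = d(A(x(t)), C(t, x(t)))`. -/
def gap (A : H → H) (C : ℝ → H → Set H) (x : ℝ → H) (t : ℝ) : ℝ :=
  Metric.infDist (A (x t)) (C t (x t))

end

end Sweeping

/-! The function `‖·‖² - d(·, S)²` is a supremum of affine functions, hence convex. Clarke
subgradients of `d(·, S)²` are therefore exactly its supergradients with quadratic error `‖u - x‖²`
(`isDistSqSupergradient_of_mem_clarkeSubdiff` and `mem_clarkeSubdiff_of_supergradient`), and they
pass to nearby sets.

Far property: points having a nearest point in a closed set are dense. By subsmoothness, the unit
proximal directions at two such points near `x` are almost parallel, so moving along the opposite of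
one of them decreases the distance at a rate close to 1, uniformly near `x`. This keeps the
subgradients away from 0.

A priori estimates: `-2λẋ` is a supergradient of the squared distance at `A(x)`, so Far gives `αφ ≤
λ‖ẋ‖ ≤ φ`. Strong monotonicity makes `φ` decrease at rate at least `λm‖ẋ‖²/φ ≥ mα²φ/λ`, while the
motion of `C` adds at most `κ̃ + L‖ẋ‖ ≤ κ̃ + Lφ/λ` (`deriv_gap_le`). Since `mα² > L`, a barrier
argument bounds `φ`, hence the speed by a constant independent of `λ`; a continuity argument then
keeps the trajectory in the ball of radius `R` up to a time independent of `λ`. -/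

namespace Sweeping

/-! ### Semiconcavity of the squared distance and its Clarke subgradients. -/

section Distance

variable {H : Type*} [NormedAddCommGroup H] [InnerProductSpace ℝ H]

/-- `w` is a supergradient of `d(·, S) ^ 2` at `x`, with quadratic error of coefficient one. -/
def IsDistSqSupergradient (S : Set H) (x w : H) : Prop :=
  ∀ u, Metric.infDist u S ^ 2 ≤ Metric.infDist x S ^ 2 + inner ℝ w (u - x) + ‖u - x‖ ^ 2

lemma norm_sq_convexComb (x y : H) {a b : ℝ} (hab : a + b = 1) :
    ‖a • x + b • y‖ ^ 2 = a * ‖x‖ ^ 2 + b * ‖y‖ ^ 2 - a * b * ‖x - y‖ ^ 2 := by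
  obtain rfl : b = 1 - a := by linarith
  rw [norm_add_sq_real, norm_sub_sq_real, inner_smul_left, inner_smul_right, norm_smul, norm_smul,
    mul_pow, mul_pow, Real.norm_eq_abs, Real.norm_eq_abs, sq_abs, sq_abs]
  simp only [conj_trivial]
  ring

/-- This is the convexity of `‖·‖² - d(·, S)² = sup_c (2⟨·, c⟩ - ‖c‖²)`. The proof uses almost
minimizers, since nearest points need not exist. -/
lemma infDist_sq_convexComb {S : Set H} (hS : S.Nonempty) (x y : H) {a b : ℝ} (ha : 0 ≤ a)
    (hb : 0 ≤ b) (hab : a + b = 1) :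
    a * Metric.infDist x S ^ 2 + b * Metric.infDist y S ^ 2 - a * b * ‖x - y‖ ^ 2 ≤
      Metric.infDist (a • x + b • y) S ^ 2 := by
  set z := a • x + b • y
  have key : ∀ r, Metric.infDist z S < r →
      a * Metric.infDist x S ^ 2 + b * Metric.infDist y S ^ 2 - a * b * ‖x - y‖ ^ 2 ≤ r ^ 2 := by
    intro r hr
    obtain ⟨c, hc, hcr⟩ := (Metric.infDist_lt_iff hS).1 hr
    have h1 : Metric.infDist x S ^ 2 ≤ ‖x - c‖ ^ 2 := by
      rw [← dist_eq_norm]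
      exact pow_le_pow_left₀ Metric.infDist_nonneg (Metric.infDist_le_dist_of_mem hc) 2
    have h2 : Metric.infDist y S ^ 2 ≤ ‖y - c‖ ^ 2 := by
      rw [← dist_eq_norm]
      exact pow_le_pow_left₀ Metric.infDist_nonneg (Metric.infDist_le_dist_of_mem hc) 2
    have h3 := norm_sq_convexComb (x - c) (y - c) hab
    have h4 : a • (x - c) + b • (y - c) = z - c := by
      have : c = (a + b) • c := by rw [hab, one_smul]
      nth_rw 3 [this]
      simp only [z]
      module
    rw [h4, sub_sub_sub_cancel_right] at h3
    have h5 : ‖z - c‖ ^ 2 ≤ r ^ 2 := by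
      rw [← dist_eq_norm]
      exact pow_le_pow_left₀ dist_nonneg hcr.le 2
    nlinarith [mul_le_mul_of_nonneg_left h1 ha, mul_le_mul_of_nonneg_left h2 hb]
  have hlim : Tendsto (fun r : ℝ => r ^ 2) (𝓝[>] (Metric.infDist z S))
      (𝓝 (Metric.infDist z S ^ 2)) :=
    ((continuous_pow 2).tendsto _).mono_left nhdsWithin_le_nhds
  exact ge_of_tendsto hlim (eventually_nhdsWithin_of_forall fun r hr => key r hr)

lemma clarkeDeriv_le_of_eventually_le {f : H → ℝ} {x h : H} {G : ℝ × H → ℝ} {B : ℝ}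
    (hG : Tendsto G (𝓝[>] (0 : ℝ) ×ˢ 𝓝 x) (𝓝 B))
    (hle : ∀ᶠ p : ℝ × H in 𝓝[>] (0 : ℝ) ×ˢ 𝓝 x, (f (p.2 + p.1 • h) - f p.2) / p.1 ≤ G p) :
    clarkeDeriv f x h ≤ B := by
  have h1 : Tendsto (fun p => (G p : EReal)) (𝓝[>] (0 : ℝ) ×ˢ 𝓝 x) (𝓝 (B : EReal)) :=
    (continuous_coe_real_ereal.tendsto B).comp hG
  rw [← h1.limsup_eq]
  exact limsup_le_limsup (hle.mono fun p hp => EReal.coe_le_coe_iff.2 hp)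

/-- The upper limit is bounded below along the base points `x - s • h`: there the quotient is `(f x
- f (x - s • h)) / s`, which the supergradient inequality bounds from below. -/
lemma mem_clarkeSubdiff_of_supergradient {f : H → ℝ} {x w : H} (c : ℝ)
    (hw : ∀ u, f u ≤ f x + inner ℝ w (u - x) + c * ‖u - x‖ ^ 2) : w ∈ clarkeSubdiff f x := by
  intro h
  have hv : Tendsto (fun s : ℝ => (s, x - s • h)) (𝓝[>] 0) (𝓝[>] (0 : ℝ) ×ˢ 𝓝 x) := by
    refine tendsto_id.prodMk ?_
    have : Continuous fun s : ℝ => x - s • h := by fun_prop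
    simpa using (this.tendsto 0).mono_left (nhdsWithin_le_nhds (s := Ioi 0))
  have h1 := hv.limsup_comp_le_limsup
    (u := fun p : ℝ × H => (((f (p.2 + p.1 • h) - f p.2) / p.1 : ℝ) : EReal))
  refine le_trans ?_ h1
  have hG : Tendsto (fun s : ℝ => inner ℝ w h - c * s * ‖h‖ ^ 2) (𝓝[>] 0) (𝓝 (inner ℝ w h)) := by
    have : Continuous fun s : ℝ => inner ℝ w h - c * s * ‖h‖ ^ 2 := by fun_prop
    simpa using (this.tendsto 0).mono_left (nhdsWithin_le_nhds (s := Ioi 0))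
  have hG' := (continuous_coe_real_ereal.tendsto _).comp hG
  rw [← hG'.limsup_eq]
  refine limsup_le_limsup ?_
  filter_upwards [self_mem_nhdsWithin] with s hs
  have hs : 0 < s := hs
  refine EReal.coe_le_coe_iff.2 ?_
  have h2 := hw (x - s • h)
  have h3 : x - s • h - x = -(s • h) := by abel
  rw [h3, inner_neg_right, inner_smul_right, norm_neg, norm_smul, mul_pow, Real.norm_eq_abs,
    sq_abs] at h2
  simp only [sub_add_cancel]
  rw [le_div_iff₀ hs]
  nlinarith

lemma isDistSqSupergradient_of_mem_clarkeSubdiff {S : Set H} (hS : S.Nonempty) {x w : H}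
    (hw : w ∈ clarkeSubdiff (fun z => Metric.infDist z S ^ 2) x) : IsDistSqSupergradient S x w := by
  intro u
  obtain ⟨k, rfl⟩ : ∃ k, u = x + k := ⟨u - x, by abel⟩
  have hd : Continuous fun z : H => Metric.infDist z S := Metric.continuous_infDist_pt S
  have hG : Tendsto (fun p : ℝ × H => Metric.infDist p.2 S ^ 2 - Metric.infDist (p.2 + k) S ^ 2 +
      (1 + p.1) * ‖k‖ ^ 2) (𝓝[>] (0 : ℝ) ×ˢ 𝓝 x)
      (𝓝 (Metric.infDist x S ^ 2 - Metric.infDist (x + k) S ^ 2 + ‖k‖ ^ 2)) := by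
    have hc : Continuous fun p : ℝ × H => Metric.infDist p.2 S ^ 2 -
        Metric.infDist (p.2 + k) S ^ 2 + (1 + p.1) * ‖k‖ ^ 2 := by fun_prop
    have h0 := hc.tendsto (0, x)
    rw [nhds_prod_eq] at h0
    simpa using h0.mono_left (prod_mono_left _ (nhdsWithin_le_nhds (s := Ioi 0)))
  have hle := clarkeDeriv_le_of_eventually_le (f := fun z => Metric.infDist z S ^ 2) (h := -k) hG ?_
  · have h1 := EReal.coe_le_coe_iff.1 ((hw (-k)).trans hle)
    rw [inner_neg_right] at h1
    rw [add_sub_cancel_left]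
    linarith
  · have hpos : ∀ᶠ p : ℝ × H in 𝓝[>] (0 : ℝ) ×ˢ 𝓝 x, 0 < p.1 :=
      tendsto_fst.eventually (eventually_nhdsWithin_of_forall fun s hs => hs)
    filter_upwards [hpos] with p hp
    obtain ⟨s, y⟩ := p
    simp only at hp ⊢
    have hs1 : (0 : ℝ) < 1 + s := by linarith
    -- The base point `y` is a convex combination of `y - s • k` and `y + k`, so semiconcavity
    -- bounds the quotient in direction `-k` by a continuous expression.
    have h1 := infDist_sq_convexComb hS (y + s • -k) (y + k) (a := 1 / (1 + s)) (b := s / (1 + s))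
      (by positivity) (by positivity) (by field_simp)
    have h2 : (1 / (1 + s)) • (y + s • -k) + (s / (1 + s)) • (y + k) = y := by
      have : y = ((1 + s) / (1 + s)) • y := by rw [div_self hs1.ne', one_smul]
      nth_rw 3 [this]
      rw [add_div]
      module
    have h3 : ‖y + s • -k - (y + k)‖ ^ 2 = (1 + s) ^ 2 * ‖k‖ ^ 2 := by
      have : y + s • -k - (y + k) = -((1 + s) • k) := by module
      rw [this, norm_neg, norm_smul, mul_pow, Real.norm_eq_abs, sq_abs]
    rw [h2, h3] at h1
    rw [div_le_iff₀ hp]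
    have h4 := mul_le_mul_of_nonneg_left h1 hs1.le
    have h5 : (1 + s) * (1 / (1 + s) * Metric.infDist (y + s • -k) S ^ 2 +
        s / (1 + s) * Metric.infDist (y + k) S ^ 2 -
        1 / (1 + s) * (s / (1 + s)) * ((1 + s) ^ 2 * ‖k‖ ^ 2)) =
        Metric.infDist (y + s • -k) S ^ 2 + s * Metric.infDist (y + k) S ^ 2 -
        s * (1 + s) * ‖k‖ ^ 2 := by
      field_simp
    rw [h5] at h4
    nlinarith

/-- Tangent-line bound for the square root: it turns one-sided estimates of `d²` into estimates of
`d`. -/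
lemma le_add_of_sq_le {a b e : ℝ} (hb : 0 < b) (h : a ^ 2 ≤ b ^ 2 + e) : a ≤ b + e / (2 * b) := by
  have : e / (2 * b) * (2 * b) = e := by field_simp
  nlinarith [sq_nonneg (a - b)]

lemma mem_clarkeSubdiff_infDist {S : Set H} {x w : H} (c : ℝ) (hx : 0 < Metric.infDist x S)
    (hw : ∀ u, Metric.infDist u S ^ 2 ≤
      Metric.infDist x S ^ 2 + inner ℝ w (u - x) + c * ‖u - x‖ ^ 2) :
    (1 / (2 * Metric.infDist x S)) • w ∈ clarkeSubdiff (fun z => Metric.infDist z S) x := by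
  refine mem_clarkeSubdiff_of_supergradient (c / (2 * Metric.infDist x S)) fun u => ?_
  have h1 := hw u
  rw [add_assoc] at h1
  refine (le_add_of_sq_le hx h1).trans_eq ?_
  rw [inner_smul_left]
  simp only [conj_trivial]
  ring

lemma IsDistSqSupergradient.norm_le {S : Set H} {x w : H} (hw : IsDistSqSupergradient S x w) :
    ‖w‖ ≤ 2 * Metric.infDist x S := by
  rcases eq_or_ne w 0 with rfl | hw0
  · simpa using Metric.infDist_nonneg
  have hwpos : 0 < ‖w‖ := norm_pos_iff.2 hw0
  -- Test the supergradient at `x - s • w`, where the distance drops by at most `s * ‖w‖`, then let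
  -- `s` tend to 0.
  have key : ∀ s : ℝ, 0 < s → ‖w‖ * (1 - s) ≤ 2 * Metric.infDist x S := by
    intro s hs
    have h1 := hw (x - s • w)
    have h2 : x - s • w - x = -(s • w) := by abel
    have h3 : Metric.infDist x S ≤ Metric.infDist (x - s • w) S + s * ‖w‖ := by
      refine (Metric.infDist_le_infDist_add_dist (y := x - s • w)).trans_eq ?_
      rw [dist_eq_norm, sub_sub_cancel, norm_smul, Real.norm_eq_abs, abs_of_pos hs]
    rw [h2, inner_neg_right, inner_smul_right, norm_neg, norm_smul, mul_pow, Real.norm_eq_abs,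
      sq_abs, real_inner_self_eq_norm_sq] at h1
    have h4 : Metric.infDist x S ^ 2 ≤
        Metric.infDist (x - s • w) S ^ 2 + 2 * Metric.infDist x S * (s * ‖w‖) := by
      have hd : 0 ≤ Metric.infDist x S := Metric.infDist_nonneg
      have hd' : 0 ≤ Metric.infDist (x - s • w) S := Metric.infDist_nonneg
      have : 0 ≤ s * ‖w‖ := by positivity
      nlinarith [mul_nonneg hd hd', sq_nonneg (Metric.infDist x S - Metric.infDist (x - s • w) S),
        mul_le_mul_of_nonneg_left h3 hd]
    have h5 : (s * ‖w‖) * (‖w‖ * (1 - s)) ≤ (s * ‖w‖) * (2 * Metric.infDist x S) := by nlinarith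
    exact le_of_mul_le_mul_left h5 (by positivity)
  have hlim : Tendsto (fun s : ℝ => ‖w‖ * (1 - s)) (𝓝[>] 0) (𝓝 ‖w‖) := by
    have : Continuous fun s : ℝ => ‖w‖ * (1 - s) := by fun_prop
    simpa using (this.tendsto 0).mono_left (nhdsWithin_le_nhds (s := Ioi 0))
  exact le_of_tendsto hlim (eventually_nhdsWithin_of_forall fun s hs => key s hs)

lemma exists_isDistSqSupergradient [CompleteSpace H] {S : Set H} (hS : S.Nonempty) (x : H) :
    ∃ w, IsDistSqSupergradient S x w := by
  set g : H → ℝ := fun u => ‖u‖ ^ 2 - Metric.infDist u S ^ 2 with hg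
  have hd : Continuous fun z : H => Metric.infDist z S := Metric.continuous_infDist_pt S
  have hgc : Continuous g := by fun_prop
  have hconv : ConvexOn ℝ univ g := by
    refine ⟨convex_univ, fun u _ v _ a b ha hb hab => ?_⟩
    have h1 := infDist_sq_convexComb hS u v ha hb hab
    have h2 := norm_sq_convexComb u v hab
    simp only [hg, smul_eq_mul]
    linarith
  have hepi : Convex ℝ {p : H × ℝ | g p.1 < p.2} := by simpa using hconv.convex_strict_epigraph
  have hopen : IsOpen {p : H × ℝ | g p.1 < p.2} :=
    isOpen_lt (hgc.comp continuous_fst) continuous_snd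
  -- A hyperplane supporting the strict epigraph of `g` at `(x, g x)`; it is not vertical because
  -- `(x, g x + 1)` lies in the epigraph.
  obtain ⟨f, hf⟩ := geometric_hahn_banach_point_open hepi hopen
    (x := (x, g x)) (by simp)
  have hsplit : ∀ u r, f (u, r) = f (u, 0) + r * f (0, 1) := by
    intro u r
    have : (u, r) = (u, (0 : ℝ)) + r • ((0 : H), (1 : ℝ)) := by simp
    rw [this, map_add, map_smul, smul_eq_mul]
  have hβ : 0 < f (0, 1) := by
    have := hf (x, g x + 1) (by simp)
    rw [hsplit x (g x), hsplit x (g x + 1)] at this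
    linarith
  have hle : ∀ u, f (x, 0) + g x * f (0, 1) ≤ f (u, 0) + g u * f (0, 1) := by
    intro u
    have hlim : Tendsto (fun r : ℝ => f (u, 0) + r * f (0, 1)) (𝓝[>] (g u))
        (𝓝 (f (u, 0) + g u * f (0, 1))) := by
      have : Continuous fun r : ℝ => f (u, 0) + r * f (0, 1) := by fun_prop
      exact (this.tendsto _).mono_left nhdsWithin_le_nhds
    refine ge_of_tendsto hlim (eventually_nhdsWithin_of_forall fun r hr => ?_)
    have := hf (u, r) hr
    rw [hsplit x, hsplit u] at this
    exact this.le
  set p := (InnerProductSpace.toDual ℝ H).symm (f.comp (ContinuousLinearMap.inl ℝ H ℝ)) with hp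
  have hpe : ∀ u, inner ℝ p u = f (u, 0) := by
    intro u
    rw [hp, InnerProductSpace.toDual_symm_apply]
    simp
  -- The gradient `2x` of `‖·‖²` minus the subgradient `-(f (0, 1))⁻¹ • p` of `g`.
  refine ⟨(2 : ℝ) • x + (f (0, 1))⁻¹ • p, fun u => ?_⟩
  have h1 := hle u
  have h2 : g x ≤ g u + (f (0, 1))⁻¹ * (f (u, 0) - f (x, 0)) := by
    have h4 : (f (0, 1))⁻¹ * f (0, 1) = 1 := inv_mul_cancel₀ hβ.ne'
    have h5 := mul_le_mul_of_nonneg_left h1 (inv_pos.2 hβ).le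
    have h6 : (f (0, 1))⁻¹ * (f (x, 0) + g x * f (0, 1)) = (f (0, 1))⁻¹ * f (x, 0) + g x := by
      rw [mul_add, mul_comm (g x), ← mul_assoc, h4, one_mul]
    have h7 : (f (0, 1))⁻¹ * (f (u, 0) + g u * f (0, 1)) = (f (0, 1))⁻¹ * f (u, 0) + g u := by
      rw [mul_add, mul_comm (g u), ← mul_assoc, h4, one_mul]
    linarith
  have h3 : ‖u‖ ^ 2 = ‖x‖ ^ 2 + 2 * inner ℝ x (u - x) + ‖u - x‖ ^ 2 := by
    rw [← norm_add_sq_real, add_sub_cancel]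
  rw [inner_add_left, inner_smul_left, inner_smul_left, hpe]
  have h4 : f (u - x, 0) = f (u, 0) - f (x, 0) := by
    rw [← map_sub]; simp
  rw [h4]
  simp only [conj_trivial]
  simp only [hg] at h2
  linarith

end Distance

/-! ### Almost nearest points, in preparation for a Baire category argument. -/

section AlmostNearest

variable {H : Type*} [NormedAddCommGroup H]

/-- The points `u` of `S` whose squared distance to `z` exceeds `d(z, S) ^ 2` by at most `η`. -/
def almostNearest (S : Set H) (z : H) (η : ℝ) : Set H :=
  {u ∈ S | ‖z - u‖ ^ 2 ≤ Metric.infDist z S ^ 2 + η}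

lemma almostNearest_nonempty {S : Set H} (hS : S.Nonempty) (z : H) {η : ℝ} (hη : 0 < η) :
    (almostNearest S z η).Nonempty := by
  have h1 : Metric.infDist z S < √(Metric.infDist z S ^ 2 + η) :=
    Real.lt_sqrt_of_sq_lt (by linarith)
  obtain ⟨c, hc, hcr⟩ := (Metric.infDist_lt_iff hS).1 h1
  refine ⟨c, hc, ?_⟩
  rw [dist_eq_norm] at hcr
  have := Metric.infDist_nonneg (x := z) (s := S)
  calc ‖z - c‖ ^ 2 ≤ √(Metric.infDist z S ^ 2 + η) ^ 2 :=
        pow_le_pow_left₀ (norm_nonneg _) hcr.le 2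
    _ = _ := Real.sq_sqrt (by positivity)

/-- The points `z` all of whose almost nearest points in `S` lie within distance `ε`. -/
def clusteredPoints (S : Set H) (ε : ℝ) : Set H :=
  {z | ∃ η > 0, ∀ u ∈ almostNearest S z η, ∀ v ∈ almostNearest S z η, ‖u - v‖ ≤ ε}

lemma eventually_almostNearest_subset (S : Set H) (z : H) {η : ℝ} (hη : 0 < η) :
    ∀ᶠ y in 𝓝 z, almostNearest S y (η / 2) ⊆ almostNearest S z η := by
  have hd : Continuous fun y : H => Metric.infDist y S := Metric.continuous_infDist_pt S
  have hc : Continuous fun y : H => 2 * ‖z - y‖ * √(Metric.infDist y S ^ 2 + η / 2) +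
      ‖z - y‖ ^ 2 + Metric.infDist y S ^ 2 + η / 2 := by fun_prop
  have hlt := hc.tendsto z
  simp only [sub_self, norm_zero, mul_zero, zero_mul, zero_add, ne_eq, OfNat.ofNat_ne_zero,
    not_false_eq_true, zero_pow] at hlt
  filter_upwards [hlt.eventually_lt_const
    (show Metric.infDist z S ^ 2 + η / 2 < Metric.infDist z S ^ 2 + η by linarith)] with y hy u hu
  refine ⟨hu.1, ?_⟩
  have h1 : ‖y - u‖ ≤ √(Metric.infDist y S ^ 2 + η / 2) := Real.le_sqrt_of_sq_le hu.2
  have h2 : ‖z - u‖ ≤ ‖z - y‖ + ‖y - u‖ := norm_sub_le_norm_sub_add_norm_sub z y u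
  have h3 : ‖z - u‖ ^ 2 ≤ (‖z - y‖ + ‖y - u‖) ^ 2 := pow_le_pow_left₀ (norm_nonneg _) h2 2
  nlinarith [mul_le_mul_of_nonneg_left h1 (norm_nonneg (z - y)), hu.2]

lemma isOpen_clusteredPoints (S : Set H) (ε : ℝ) : IsOpen (clusteredPoints S ε) := by
  refine isOpen_iff_mem_nhds.2 ?_
  rintro z ⟨η, hη, h⟩
  filter_upwards [eventually_almostNearest_subset S z hη] with y hy
  exact ⟨η / 2, by positivity, fun u hu v hv => h u (hy hu) v (hy hv)⟩

end AlmostNearest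

/-! ### Density of points with a nearest point, and the Far property of subsmooth sets. -/

section NearestPoints

variable {H : Type*} [NormedAddCommGroup H] [InnerProductSpace ℝ H]

/-- Moving `z` a little towards an almost nearest point `c` makes `c` strictly preferred: by the
identity for convex combinations, every almost nearest point of the moved point is close to `c`. -/
lemma dense_clusteredPoints {S : Set H} (hS : S.Nonempty) {ε : ℝ} (hε : 0 < ε) :
    Dense (clusteredPoints S ε) := by
  rw [Metric.dense_iff]
  intro z r hr
  set D := Metric.infDist z S
  have hD : 0 ≤ D := Metric.infDist_nonneg
  obtain ⟨θ, hθ, hθ1, hθr⟩ : ∃ θ : ℝ, 0 < θ ∧ θ ≤ 1 ∧ θ * (D + 1) < r := by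
    refine ⟨min 1 (r / (2 * (D + 1))), by positivity, min_le_left _ _, ?_⟩
    calc min 1 (r / (2 * (D + 1))) * (D + 1) ≤ r / (2 * (D + 1)) * (D + 1) := by
          gcongr; exact min_le_right _ _
      _ = r / 2 := by field_simp
      _ < r := by linarith
  -- Below, `θ * ‖c - u‖ ^ 2 ≤ 2 * η`: one `η` comes from `c`, the other from `u`.
  obtain ⟨η, hη, hη1, hηε⟩ : ∃ η : ℝ, 0 < η ∧ η ≤ 1 ∧ 2 * η ≤ θ * (ε / 2) ^ 2 :=
    ⟨min 1 (θ * (ε / 2) ^ 2 / 2), by positivity, min_le_left _ _, by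
      have := min_le_right 1 (θ * (ε / 2) ^ 2 / 2); linarith⟩
  obtain ⟨c, hc, hcη⟩ := almostNearest_nonempty hS z hη
  have hclose : ∀ u ∈ almostNearest S ((1 - θ) • z + θ • c) η, ‖c - u‖ ≤ ε / 2 := by
    rintro u ⟨huS, hu⟩
    have h1 := norm_sq_convexComb (z - u) (c - u) (show 1 - θ + θ = 1 by ring)
    have h2 : (1 - θ) • (z - u) + θ • (c - u) = (1 - θ) • z + θ • c - u := by module
    rw [h2, sub_sub_sub_cancel_right] at h1
    have h3 : Metric.infDist ((1 - θ) • z + θ • c) S ≤ (1 - θ) * ‖z - c‖ := by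
      refine (Metric.infDist_le_dist_of_mem hc).trans_eq ?_
      have : (1 - θ) • z + θ • c - c = (1 - θ) • (z - c) := by module
      rw [dist_eq_norm, this, norm_smul, Real.norm_eq_abs, abs_of_nonneg (by linarith)]
    have h4 : Metric.infDist ((1 - θ) • z + θ • c) S ^ 2 ≤ ((1 - θ) * ‖z - c‖) ^ 2 :=
      pow_le_pow_left₀ Metric.infDist_nonneg h3 2
    have h5 : D ^ 2 ≤ ‖z - u‖ ^ 2 := by
      rw [← dist_eq_norm]
      exact pow_le_pow_left₀ Metric.infDist_nonneg (Metric.infDist_le_dist_of_mem huS) 2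
    have h6 : θ * ‖c - u‖ ^ 2 ≤ θ * (ε / 2) ^ 2 := by
      have e1 : (1 - θ) * D ^ 2 ≤ (1 - θ) * ‖z - u‖ ^ 2 :=
        mul_le_mul_of_nonneg_left h5 (by linarith)
      have e2 : (1 - θ) * (‖z - c‖ ^ 2 - D ^ 2) ≤ 1 * η := by
        have : 0 ≤ ‖z - c‖ ^ 2 - D ^ 2 := by
          have : D ^ 2 ≤ ‖z - c‖ ^ 2 := by
            rw [← dist_eq_norm]
            exact pow_le_pow_left₀ Metric.infDist_nonneg (Metric.infDist_le_dist_of_mem hc) 2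
          linarith
        have : ‖z - c‖ ^ 2 - D ^ 2 ≤ η := by linarith
        exact mul_le_mul (by linarith) this (by linarith) zero_le_one
      nlinarith
    exact le_of_sq_le_sq (le_of_mul_le_mul_left h6 hθ) (by positivity)
  refine ⟨(1 - θ) • z + θ • c, ?_, η, hη, fun u hu v hv => ?_⟩
  · rw [Metric.mem_ball, dist_eq_norm]
    have h1 : (1 - θ) • z + θ • c - z = θ • (c - z) := by module
    rw [h1, norm_smul, Real.norm_eq_abs, abs_of_pos hθ, norm_sub_rev]
    have h2 : ‖z - c‖ ≤ D + 1 := le_of_sq_le_sq (by nlinarith) (by positivity)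
    exact lt_of_le_of_lt (mul_le_mul_of_nonneg_left h2 hθ.le) hθr
  · have h1 := hclose u hu
    have h2 := hclose v hv
    calc ‖u - v‖ = ‖(c - v) - (c - u)‖ := by congr 1; abel
      _ ≤ ‖c - v‖ + ‖c - u‖ := norm_sub_le _ _
      _ ≤ ε := by linarith

/-- By Baire, the points that are clustered at every scale are dense. At such a point minimizing
sequences are Cauchy, and their limit is a nearest point. -/
lemma dense_exists_nearest [CompleteSpace H] {S : Set H} (hS : S.Nonempty) (hcl : IsClosed S) :
    Dense {z : H | ∃ p ∈ S, ‖z - p‖ = Metric.infDist z S} := by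
  have hdense : Dense (⋂ n : ℕ, clusteredPoints S (1 / ((n : ℝ) + 1))) :=
    dense_iInter_of_isOpen_nat (fun n => isOpen_clusteredPoints S _)
      fun n => dense_clusteredPoints hS Nat.one_div_pos_of_nat
  refine hdense.mono fun z hz => ?_
  rw [mem_iInter] at hz
  have hex : ∀ n : ℕ, ∃ u, u ∈ almostNearest S z (1 / ((n : ℝ) + 1)) := fun n =>
    almostNearest_nonempty hS z Nat.one_div_pos_of_nat
  choose u hu using hex
  have hlim0 : Tendsto (fun n : ℕ => 1 / ((n : ℝ) + 1)) atTop (𝓝 0) :=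
    tendsto_one_div_add_atTop_nhds_zero_nat
  have hcauchy : CauchySeq u := by
    rw [Metric.cauchySeq_iff]
    intro ε hε
    obtain ⟨n, hn⟩ := exists_nat_one_div_lt hε
    obtain ⟨η, hη, hclus⟩ := hz n
    obtain ⟨N, hN⟩ := exists_nat_one_div_lt hη
    have hmem : ∀ k ≥ N, u k ∈ almostNearest S z η := by
      intro k hk
      refine ⟨(hu k).1, (hu k).2.trans ?_⟩
      have : 1 / ((k : ℝ) + 1) ≤ 1 / ((N : ℝ) + 1) := by gcongr
      linarith
    refine ⟨N, fun k hk l hl => ?_⟩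
    rw [dist_eq_norm]
    exact (hclus _ (hmem k hk) _ (hmem l hl)).trans_lt hn
  obtain ⟨p, hp⟩ := cauchySeq_tendsto_of_complete hcauchy
  have hpS : p ∈ S := hcl.mem_of_tendsto hp (Eventually.of_forall fun n => (hu n).1)
  refine ⟨p, hpS, le_antisymm ?_ ?_⟩
  · have h1 : Tendsto (fun n => ‖z - u n‖ ^ 2) atTop (𝓝 (‖z - p‖ ^ 2)) :=
      ((tendsto_const_nhds.sub hp).norm).pow 2
    have h2 : Tendsto (fun n : ℕ => Metric.infDist z S ^ 2 + 1 / ((n : ℝ) + 1)) atTop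
        (𝓝 (Metric.infDist z S ^ 2)) := by simpa using tendsto_const_nhds.add hlim0
    exact le_of_sq_le_sq (le_of_tendsto_of_tendsto' h1 h2 fun n => (hu n).2) Metric.infDist_nonneg
  · rw [← dist_eq_norm]
    exact Metric.infDist_le_dist_of_mem hpS

/-- A tangent direction tested with the constant base sequence `p` yields points of `S`, none closer
to `z` than `p`; expanding the square gives the sign. -/
lemma smul_sub_mem_clarkeNormalCone {S : Set H} {z p : H} (hp : p ∈ S)
    (hzp : ‖z - p‖ = Metric.infDist z S) {c : ℝ} (hc : 0 ≤ c) :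
    c • (z - p) ∈ clarkeNormalCone S p := by
  refine ⟨hp, fun h hh => ?_⟩
  have hlim0 : Tendsto (fun n : ℕ => 1 / ((n : ℝ) + 1)) atTop (𝓝 0) :=
    tendsto_one_div_add_atTop_nhds_zero_nat
  obtain ⟨g, hg, hgS⟩ := hh (fun _ => p) (fun n => 1 / ((n : ℝ) + 1)) (fun _ => hp)
    tendsto_const_nhds (fun n => Nat.one_div_pos_of_nat) hlim0
  have hle : ∀ n : ℕ, 2 * inner ℝ (z - p) (g n) ≤ 1 / ((n : ℝ) + 1) * ‖g n‖ ^ 2 := by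
    intro n
    set s : ℝ := 1 / ((n : ℝ) + 1)
    have hs : 0 < s := Nat.one_div_pos_of_nat
    have h1 : ‖z - p‖ ^ 2 ≤ ‖(z - p) - s • g n‖ ^ 2 := by
      rw [hzp, sub_sub, ← dist_eq_norm]
      exact pow_le_pow_left₀ Metric.infDist_nonneg (Metric.infDist_le_dist_of_mem (hgS n)) 2
    rw [norm_sub_sq_real (z - p), inner_smul_right, norm_smul, mul_pow, Real.norm_eq_abs,
      sq_abs] at h1
    have h2 : s * (2 * inner ℝ (z - p) (g n)) ≤ s * (s * ‖g n‖ ^ 2) := by linarith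
    exact le_of_mul_le_mul_left h2 hs
  have h1 : Tendsto (fun n => 2 * inner ℝ (z - p) (g n)) atTop (𝓝 (2 * inner ℝ (z - p) h)) :=
    (tendsto_const_nhds.inner hg).const_mul 2
  have h2 : Tendsto (fun n : ℕ => 1 / ((n : ℝ) + 1) * ‖g n‖ ^ 2) atTop (𝓝 (0 * ‖h‖ ^ 2)) :=
    hlim0.mul (hg.norm.pow 2)
  have h3 := le_of_tendsto_of_tendsto' h1 h2 hle
  rw [inner_smul_left]
  simp only [conj_trivial]
  exact mul_nonpos_of_nonneg_of_nonpos hc (by linarith)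

/-- For a set satisfying the subsmoothness inequality at scale `δ`, unit proximal normals taken at
nearby points `z₁`, `z₂` of the tube of radius `δ / 3` are nearly parallel. -/
lemma inner_proximal_ge {S : Set H} {ε δ d e : ℝ} (hε : 0 ≤ ε) (hd : 0 < d)
    (hsub : ∀ x₁ ∈ S, ∀ x₂ ∈ S, ‖x₁ - x₂‖ < δ →
      ∀ w₁ ∈ clarkeNormalCone S x₁, ∀ w₂ ∈ clarkeNormalCone S x₂,
        ‖w₁‖ ≤ 1 → ‖w₂‖ ≤ 1 → -ε * ‖x₁ - x₂‖ ≤ inner ℝ (w₁ - w₂) (x₁ - x₂))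
    {z₁ z₂ p₁ p₂ : H} (hp₁ : p₁ ∈ S) (hp₂ : p₂ ∈ S)
    (h₁ : ‖z₁ - p₁‖ = Metric.infDist z₁ S) (h₂ : ‖z₂ - p₂‖ = Metric.infDist z₂ S)
    (hpos₁ : 0 < ‖z₁ - p₁‖) (hpos₂ : 0 < ‖z₂ - p₂‖)
    (hlt₁ : ‖z₁ - p₁‖ < δ / 3) (hlt₂ : ‖z₂ - p₂‖ < δ / 3) (hz : ‖z₁ - z₂‖ < δ / 3)
    (he : ‖z₁ - z₂‖ + |‖z₁ - p₁‖ - d| + |‖z₂ - p₂‖ - d| ≤ e) :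
    1 - ε - (2 + ε) * e / (2 * d) ≤
      inner ℝ (‖z₁ - p₁‖⁻¹ • (z₁ - p₁)) (‖z₂ - p₂‖⁻¹ • (z₂ - p₂)) := by
  set w₁ := ‖z₁ - p₁‖⁻¹ • (z₁ - p₁) with hw₁
  set w₂ := ‖z₂ - p₂‖⁻¹ • (z₂ - p₂) with hw₂
  have hn₁ : ‖w₁‖ = 1 := by
    rw [hw₁, norm_smul, norm_inv, norm_norm, inv_mul_cancel₀ hpos₁.ne']
  have hn₂ : ‖w₂‖ = 1 := by
    rw [hw₂, norm_smul, norm_inv, norm_norm, inv_mul_cancel₀ hpos₂.ne']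
  have hq₁ : z₁ - p₁ = ‖z₁ - p₁‖ • w₁ := by
    rw [hw₁, smul_smul, mul_inv_cancel₀ hpos₁.ne', one_smul]
  have hq₂ : z₂ - p₂ = ‖z₂ - p₂‖ • w₂ := by
    rw [hw₂, smul_smul, mul_inv_cancel₀ hpos₂.ne', one_smul]
  have hpp : p₁ - p₂ = (z₁ - z₂) - (z₁ - p₁) + (z₂ - p₂) := by abel
  have hclose : ‖p₁ - p₂‖ < δ := by
    have : ‖p₁ - p₂‖ ≤ ‖z₁ - z₂‖ + ‖z₁ - p₁‖ + ‖z₂ - p₂‖ := by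
      rw [hpp]
      exact (norm_add_le _ _).trans (by gcongr; exact norm_sub_le _ _)
    linarith
  have hmain := hsub p₁ hp₁ p₂ hp₂ hclose w₁
    (smul_sub_mem_clarkeNormalCone hp₁ h₁ (by positivity)) w₂
    (smul_sub_mem_clarkeNormalCone hp₂ h₂ (by positivity)) hn₁.le hn₂.le
  -- Replacing both distances by the common value `d` leaves an error `E`. Then `p₁ - p₂ = E - d •
  -- (w₁ - w₂)`, and subsmoothness becomes an upper bound on `d * ‖w₁ - w₂‖ ^ 2`.
  set E := (z₁ - z₂) - (‖z₁ - p₁‖ - d) • w₁ + (‖z₂ - p₂‖ - d) • w₂ with hE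
  have hpE : p₁ - p₂ = E - d • (w₁ - w₂) := by
    rw [hpp, hq₁, hq₂, hE]
    module
  have hEe : ‖E‖ ≤ e := by
    refine le_trans ?_ he
    rw [hE]
    refine (norm_add_le _ _).trans ?_
    rw [norm_smul, hn₂, mul_one, Real.norm_eq_abs]
    gcongr
    refine (norm_sub_le _ _).trans ?_
    rw [norm_smul, hn₁, mul_one, Real.norm_eq_abs]
  set Q := ‖w₁ - w₂‖ with hQ
  have hQ2 : Q ≤ 2 := (norm_sub_le _ _).trans (by rw [hn₁, hn₂]; norm_num)
  have hQ0 : 0 ≤ Q := norm_nonneg _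
  have he0 : 0 ≤ e := (norm_nonneg _).trans hEe
  have hpn : ‖p₁ - p₂‖ ≤ e + d * Q := by
    rw [hpE]
    refine (norm_sub_le _ _).trans ?_
    rw [norm_smul, Real.norm_eq_abs, abs_of_pos hd]
    gcongr
  have hin : inner ℝ (w₁ - w₂) (p₁ - p₂) ≤ Q * e - d * Q ^ 2 := by
    rw [hpE, inner_sub_right, inner_smul_right, real_inner_self_eq_norm_sq]
    gcongr
    exact (real_inner_le_norm _ _).trans (by gcongr)
  have hQsq : Q ^ 2 = 2 - 2 * inner ℝ w₁ w₂ := by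
    rw [hQ, norm_sub_sq_real, hn₁, hn₂]; ring
  have hfin : d * Q ^ 2 ≤ 2 * e + ε * e + 2 * ε * d := by
    have e1 : -ε * ‖p₁ - p₂‖ ≥ -ε * (e + d * Q) := by nlinarith
    have e2 : Q * e ≤ 2 * e := by nlinarith
    have e3 : ε * (d * Q) ≤ ε * (d * 2) := by gcongr
    nlinarith
  rw [hQsq] at hfin
  have h3 : (2 + ε) * e / (2 * d) * (2 * d) = (2 + ε) * e := by field_simp
  nlinarith

lemma le_norm_of_mem_clarkeSubdiff_infDist [CompleteSpace H] {S : Set H} (hS : S.Nonempty)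
    (hcl : IsClosed S) {ε δ : ℝ} (hε : 0 < ε)
    (hsub : ∀ x₁ ∈ S, ∀ x₂ ∈ S, ‖x₁ - x₂‖ < δ →
      ∀ w₁ ∈ clarkeNormalCone S x₁, ∀ w₂ ∈ clarkeNormalCone S x₂,
        ‖w₁‖ ≤ 1 → ‖w₂‖ ≤ 1 → -ε * ‖x₁ - x₂‖ ≤ inner ℝ (w₁ - w₂) (x₁ - x₂))
    {x w : H} (hx : 0 < Metric.infDist x S) (hxδ : Metric.infDist x S < δ / 3)
    (hw : w ∈ clarkeSubdiff (fun z => Metric.infDist z S) x) : 1 - 2 * ε ≤ ‖w‖ := by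
  set d := Metric.infDist x S with hd
  have hdc : Continuous fun y : H => Metric.infDist y S := Metric.continuous_infDist_pt S
  have hdense := dense_exists_nearest hS hcl
  -- With this `e` the error term of `inner_proximal_ge` equals `ε`, so its lower bound is `1 - 2 *
  -- ε`.
  obtain ⟨e, he, hee⟩ : ∃ e : ℝ, 0 < e ∧ (2 + ε) * e / (2 * d) = ε :=
    ⟨ε * (2 * d) / (2 + ε), by positivity, by field_simp⟩
  have hδ : 0 < δ := by linarith
  -- a neighbourhood on which the estimates hold
  have hnear : ∀ᶠ y in 𝓝 x, 0 < Metric.infDist y S ∧ Metric.infDist y S < δ / 3 ∧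
      ‖y - x‖ < δ / 6 ∧ ‖y - x‖ < e / 4 ∧ |Metric.infDist y S - d| < e / 4 := by
    have h1 := (hdc.tendsto x).eventually_const_lt hx
    have h2 := (hdc.tendsto x).eventually_lt_const hxδ
    have hc3 : Tendsto (fun y : H => ‖y - x‖) (𝓝 x) (𝓝 0) := by
      have : Continuous fun y : H => ‖y - x‖ := by fun_prop
      simpa using this.tendsto x
    have hc4 : Tendsto (fun y : H => |Metric.infDist y S - d|) (𝓝 x) (𝓝 0) := by
      have : Continuous fun y : H => |Metric.infDist y S - d| := by fun_prop
      simpa [hd] using this.tendsto x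
    filter_upwards [h1, h2, hc3.eventually_lt_const (show 0 < δ / 6 by positivity),
      hc3.eventually_lt_const (show 0 < e / 4 by positivity),
      hc4.eventually_lt_const (show 0 < e / 4 by positivity)] with y a1 a2 a3 a4 a5
    exact ⟨a1, a2, a3, a4, a5⟩
  obtain ⟨U, hUx, hUo, hxU⟩ : ∃ U : Set H, (∀ y ∈ U, 0 < Metric.infDist y S ∧
      Metric.infDist y S < δ / 3 ∧ ‖y - x‖ < δ / 6 ∧ ‖y - x‖ < e / 4 ∧
      |Metric.infDist y S - d| < e / 4) ∧ IsOpen U ∧ x ∈ U := by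
    obtain ⟨U, hU, hUo, hxU⟩ := eventually_nhds_iff.1 hnear
    exact ⟨U, hU, hUo, hxU⟩
  obtain ⟨z₁, hz₁U, p₁, hp₁, hzp₁⟩ := hdense.inter_open_nonempty U hUo ⟨x, hxU⟩
  obtain ⟨a1, a2, a3, a4, a5⟩ := hUx z₁ hz₁U
  set w₁ := ‖z₁ - p₁‖⁻¹ • (z₁ - p₁) with hw₁
  have hn₁ : ‖w₁‖ = 1 := by
    rw [hw₁, norm_smul, norm_inv, norm_norm, inv_mul_cancel₀ (by rw [hzp₁]; exact a1.ne')]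
  -- Descent along the fixed direction `-w₁`, uniform over `U`: it is proved at points with a
  -- nearest point and extended by density, the inequality being closed in `y`.
  have hdir : ∀ s : ℝ, 0 < s → ∀ y ∈ U, Metric.infDist (y + s • -w₁) S ^ 2 ≤
      Metric.infDist y S ^ 2 - 2 * s * Metric.infDist y S * (1 - 2 * ε) + s ^ 2 := by
    intro s hs y hy
    have hclosed : IsClosed {y : H | Metric.infDist (y + s • -w₁) S ^ 2 ≤
        Metric.infDist y S ^ 2 - 2 * s * Metric.infDist y S * (1 - 2 * ε) + s ^ 2} :=
      isClosed_le (by fun_prop) (by fun_prop)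
    refine hclosed.closure_subset_iff.2 ?_ (hdense.open_subset_closure_inter hUo hy)
    rintro z ⟨hzU, p, hp, hzp⟩
    obtain ⟨b1, b2, b3, b4, b5⟩ := hUx z hzU
    have hzz : ‖z - z₁‖ ≤ ‖z - x‖ + ‖z₁ - x‖ := by
      rw [norm_sub_rev z₁ x]; exact norm_sub_le_norm_sub_add_norm_sub _ _ _
    have hinner := inner_proximal_ge hε.le hx hsub hp hp₁ hzp hzp₁ (hzp ▸ b1) (hzp₁ ▸ a1)
      (hzp ▸ b2) (hzp₁ ▸ a2) (by linarith)
      (show _ ≤ e by rw [hzp, hzp₁]; linarith)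
    rw [hee, ← hw₁, inner_smul_left, hzp] at hinner
    simp only [conj_trivial] at hinner
    have h1 : Metric.infDist z S * (1 - 2 * ε) ≤ inner ℝ (z - p) w₁ := by
      have := mul_le_mul_of_nonneg_left hinner b1.le
      rw [← mul_assoc, mul_inv_cancel₀ b1.ne', one_mul] at this
      linarith
    have h2 : Metric.infDist (z + s • -w₁) S ^ 2 ≤ ‖(z - p) - s • w₁‖ ^ 2 := by
      have : (z - p) - s • w₁ = (z + s • -w₁) - p := by module
      rw [this, ← dist_eq_norm]
      exact pow_le_pow_left₀ Metric.infDist_nonneg (Metric.infDist_le_dist_of_mem hp) 2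
    rw [norm_sub_sq_real (z - p), inner_smul_right, norm_smul, hn₁, mul_one, hzp, Real.norm_eq_abs,
      sq_abs] at h2
    simp only [mem_ofPred_eq]
    nlinarith [mul_le_mul_of_nonneg_left h1 hs.le]
  have hG : Tendsto (fun p : ℝ × H => -(1 - 2 * ε) + p.1 / (2 * Metric.infDist p.2 S))
      (𝓝[>] (0 : ℝ) ×ˢ 𝓝 x) (𝓝 (-(1 - 2 * ε))) := by
    have h1 : Tendsto (fun p : ℝ × H => p.1) (𝓝[>] (0 : ℝ) ×ˢ 𝓝 x) (𝓝 0) :=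
      tendsto_fst.mono_right nhdsWithin_le_nhds
    have h2 : Tendsto (fun p : ℝ × H => 2 * Metric.infDist p.2 S) (𝓝[>] (0 : ℝ) ×ˢ 𝓝 x)
        (𝓝 (2 * d)) := ((hdc.tendsto x).comp tendsto_snd).const_mul 2
    simpa using (h1.div h2 (by positivity)).const_add (-(1 - 2 * ε))
  have hle := clarkeDeriv_le_of_eventually_le (f := fun z => Metric.infDist z S) (h := -w₁) hG ?_
  · have h1 := EReal.coe_le_coe_iff.1 ((hw (-w₁)).trans hle)
    rw [inner_neg_right] at h1
    have h2 := real_inner_le_norm w w₁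
    rw [hn₁, mul_one] at h2
    linarith
  · have hpos : ∀ᶠ p : ℝ × H in 𝓝[>] (0 : ℝ) ×ˢ 𝓝 x, 0 < p.1 :=
      tendsto_fst.eventually (eventually_nhdsWithin_of_forall fun s hs => hs)
    have hmemU : ∀ᶠ p : ℝ × H in 𝓝[>] (0 : ℝ) ×ˢ 𝓝 x, p.2 ∈ U :=
      tendsto_snd.eventually (hUo.mem_nhds hxU)
    filter_upwards [hpos, hmemU] with p hp hpU
    have hb := (hUx p.2 hpU).1
    have h1 := hdir p.1 hp p.2 hpU
    rw [div_le_iff₀ hp]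
    have h2 := le_add_of_sq_le (a := Metric.infDist (p.2 + p.1 • -w₁) S) hb
      (e := - (2 * p.1 * Metric.infDist p.2 S * (1 - 2 * ε)) + p.1 ^ 2) (by linarith)
    have h3 : (- (2 * p.1 * Metric.infDist p.2 S * (1 - 2 * ε)) + p.1 ^ 2) /
        (2 * Metric.infDist p.2 S) =
        (-(1 - 2 * ε) + p.1 / (2 * Metric.infDist p.2 S)) * p.1 := by
      field_simp
    linarith

lemma exists_positivelyFar [CompleteSpace H] {C : ℝ → H → Set H} {T : ℝ}
    (hCne : ∀ t ∈ Icc 0 T, ∀ x, (C t x).Nonempty)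
    (hCcl : ∀ t ∈ Icc 0 T, ∀ x, IsClosed (C t x))
    (hC : EquiUniformlySubsmooth C T) {α : ℝ} (hα : α < 1) :
    ∃ ρ : ℝ≥0∞, 0 < ρ ∧ PositivelyFar C T α ρ := by
  -- The tolerance `ε = (1 - α) / 2` solves `1 - 2 * ε = α`.
  obtain ⟨δ, hδ, hsub⟩ := hC ((1 - α) / 2) (by linarith)
  refine ⟨ENNReal.ofReal (δ / 3), by simpa using hδ, fun y => ?_⟩
  filter_upwards [ae_restrict_mem measurableSet_Icc] with t ht x hx hxρ
  have hS := hCne t ht y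
  obtain ⟨w, hw⟩ := exists_isDistSqSupergradient hS x
  -- Nonemptiness matters: `Metric.infDist` to the empty set is 0.
  have hne : (clarkeSubdiff (fun z => Metric.infDist z (C t y)) x).Nonempty :=
    ⟨_, mem_clarkeSubdiff_infDist 1 hx fun u => by rw [one_mul]; exact hw u⟩
  refine (Metric.le_infDist hne).2 fun {v} hv => ?_
  have h1 := le_norm_of_mem_clarkeSubdiff_infDist hS (hCcl t ht y)
    (show 0 < (1 - α) / 2 by linarith) (hsub t ht y) hx
    ((ENNReal.ofReal_lt_ofReal_iff (by positivity)).1 hxρ) hv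
  rw [dist_zero_left]
  linarith

end NearestPoints

/-! ### Stability of the Far property under perturbation of the set. -/

section Stability

variable {H : Type*} [NormedAddCommGroup H] [InnerProductSpace ℝ H]

lemma exists_forall_le_of_midpoint_strongly_concave [CompleteSpace H] {F : H → ℝ}
    (hF : Continuous F) (hbdd : BddAbove (range F)) {c : ℝ} (hc : 0 < c)
    (hmid : ∀ u v, (F u + F v) / 2 + c * ‖u - v‖ ^ 2 ≤ F ((1 / 2 : ℝ) • u + (1 / 2 : ℝ) • v)) :
    ∃ z, ∀ u, F u ≤ F z := by
  set s := sSup (range F)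
  have hle : ∀ u, F u ≤ s := fun u => le_csSup hbdd (mem_range_self u)
  have hex : ∀ n : ℕ, ∃ u, s - 1 / ((n : ℝ) + 1) < F u := by
    intro n
    have hpos : (0 : ℝ) < 1 / ((n : ℝ) + 1) := Nat.one_div_pos_of_nat
    obtain ⟨_, ⟨u, rfl⟩, hu⟩ := exists_lt_of_lt_csSup (range_nonempty F)
      (show s - 1 / ((n : ℝ) + 1) < s by linarith)
    exact ⟨u, hu⟩
  choose u hu using hex
  have hlim0 : Tendsto (fun n : ℕ => 1 / ((n : ℝ) + 1)) atTop (𝓝 0) :=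
    tendsto_one_div_add_atTop_nhds_zero_nat
  have hcauchy : CauchySeq u := by
    rw [Metric.cauchySeq_iff]
    intro ε hε
    obtain ⟨N, hN⟩ := exists_nat_one_div_lt (show 0 < c * ε ^ 2 by positivity)
    have hmem : ∀ k ≥ N, s - c * ε ^ 2 < F (u k) := by
      intro k hk
      have h1 : 1 / ((k : ℝ) + 1) ≤ 1 / ((N : ℝ) + 1) := by gcongr
      linarith [hu k]
    refine ⟨N, fun k hk l hl => ?_⟩
    rw [dist_eq_norm]
    have h1 := (hmid (u k) (u l)).trans (hle _)
    have h2 : c * ‖u k - u l‖ ^ 2 < c * ε ^ 2 := by linarith [hmem k hk, hmem l hl]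
    exact lt_of_pow_lt_pow_left₀ 2 hε.le (lt_of_mul_lt_mul_left h2 hc.le)
  obtain ⟨z, hz⟩ := cauchySeq_tendsto_of_complete hcauchy
  refine ⟨z, fun v => (hle v).trans ?_⟩
  have h1 : Tendsto (fun n : ℕ => s - 1 / ((n : ℝ) + 1)) atTop (𝓝 s) := by
    simpa using hlim0.const_sub s
  exact le_of_tendsto_of_tendsto' h1 ((hF.tendsto z).comp hz) fun n => (hu n).le

/-- A supergradient of `d(·, S) ^ 2` at `x` is close to a supergradient at a nearby point of the
squared distance function to a set `S'` close to `S`. -/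
lemma IsDistSqSupergradient.exists_near [CompleteSpace H] {S S' : Set H} (hS' : S'.Nonempty)
    {x w : H} (hw : IsDistSqSupergradient S x w) {η : ℝ} (hη : 0 ≤ η)
    (hclose : ∀ z, |Metric.infDist z S' - Metric.infDist z S| ≤ η) :
    ∃ z, ‖z - x‖ ≤ η + √(4 * η * Metric.infDist x S + 2 * η ^ 2) ∧
      ∀ u, Metric.infDist u S' ^ 2 ≤ Metric.infDist z S' ^ 2 +
        inner ℝ (w + (4 : ℝ) • (z - x)) (u - z) + 2 * ‖u - z‖ ^ 2 := by
  have hdc : Continuous fun y : H => Metric.infDist y S' := Metric.continuous_infDist_pt S'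
  -- Doubling the quadratic coefficient makes `F` strongly concave, so its maximum is attained.
  -- Maximality at `z` is the required inequality, and `F x ≤ F z` bounds `‖z - x‖`.
  set F : H → ℝ := fun u => Metric.infDist u S' ^ 2 - inner ℝ w (u - x) - 2 * ‖u - x‖ ^ 2 with hF
  have hFc : Continuous F := by fun_prop
  have hbdd : BddAbove (range F) := by
    set d := Metric.infDist x S'
    refine ⟨d ^ 2 + (2 * d + ‖w‖) ^ 2 / 4, ?_⟩
    rintro _ ⟨u, rfl⟩
    have h1 : Metric.infDist u S' ≤ d + ‖u - x‖ := by
      rw [← dist_eq_norm]; exact Metric.infDist_le_infDist_add_dist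
    have h2 : Metric.infDist u S' ^ 2 ≤ (d + ‖u - x‖) ^ 2 :=
      pow_le_pow_left₀ Metric.infDist_nonneg h1 2
    have h3 := neg_le_of_abs_le (abs_real_inner_le_norm w (u - x))
    simp only [hF]
    nlinarith [sq_nonneg (‖u - x‖ - (2 * d + ‖w‖) / 2)]
  have hmid : ∀ u v, (F u + F v) / 2 + 1 / 4 * ‖u - v‖ ^ 2 ≤
      F ((1 / 2 : ℝ) • u + (1 / 2 : ℝ) • v) := by
    intro u v
    have h1 := infDist_sq_convexComb hS' u v (a := 1 / 2) (b := 1 / 2) (by norm_num)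
      (by norm_num) (by norm_num)
    have h2 := norm_sq_convexComb (u - x) (v - x) (a := 1 / 2) (b := 1 / 2) (by norm_num)
    have h3 : (1 / 2 : ℝ) • u + (1 / 2 : ℝ) • v - x =
        (1 / 2 : ℝ) • (u - x) + (1 / 2 : ℝ) • (v - x) := by module
    rw [sub_sub_sub_cancel_right] at h2
    simp only [hF]
    rw [h3, h2, inner_add_right, inner_smul_right, inner_smul_right]
    linarith
  obtain ⟨z, hz⟩ := exists_forall_le_of_midpoint_strongly_concave hFc hbdd (by norm_num) hmid
  refine ⟨z, ?_, fun u => ?_⟩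
  · set d := Metric.infDist x S
    have hd : 0 ≤ d := Metric.infDist_nonneg
    have h1 := hz x
    simp only [hF, sub_self, inner_zero_right, norm_zero] at h1
    have h2 := hw z
    have h3 := abs_le.1 (hclose z)
    have h4 := abs_le.1 (hclose x)
    have h5 : Metric.infDist z S ≤ d + ‖z - x‖ := by
      rw [← dist_eq_norm]; exact Metric.infDist_le_infDist_add_dist
    have h6 : d ^ 2 - 2 * d * η ≤ Metric.infDist x S' ^ 2 := by
      nlinarith [sq_nonneg (Metric.infDist x S' - d)]
    have h7 : Metric.infDist z S' ^ 2 ≤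
        Metric.infDist z S ^ 2 + 2 * η * (d + ‖z - x‖) + η ^ 2 := by
      have : Metric.infDist z S' ^ 2 ≤ (Metric.infDist z S + η) ^ 2 :=
        pow_le_pow_left₀ Metric.infDist_nonneg (by linarith) 2
      nlinarith
    have h8 : (‖z - x‖ - η) ^ 2 ≤ 4 * η * d + 2 * η ^ 2 := by nlinarith
    linarith [Real.le_sqrt_of_sq_le h8]
  · have h1 := hz u
    simp only [hF] at h1
    have h2 : u - x = (z - x) + (u - z) := by abel
    have h3 : ‖u - x‖ ^ 2 = ‖z - x‖ ^ 2 + 2 * inner ℝ (z - x) (u - z) + ‖u - z‖ ^ 2 := by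
      rw [h2, norm_add_sq_real]
    have h4 : inner ℝ w (u - x) = inner ℝ w (z - x) + inner ℝ w (u - z) := by
      rw [h2, inner_add_right]
    rw [inner_add_left, inner_smul_left]
    simp only [conj_trivial]
    linarith

/-- The Clarke subdifferential of the distance function to `S` stays at distance at least `α` from
the origin on the open tube of radius `ρ` around `S`. -/
def FarSet (S : Set H) (α : ℝ) (ρ : ℝ≥0∞) : Prop :=
  ∀ x : H, 0 < Metric.infDist x S → ENNReal.ofReal (Metric.infDist x S) < ρ →
    α ≤ Metric.infDist 0 (clarkeSubdiff (fun z => Metric.infDist z S) x)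

/-- The supergradient `w` is transferred to points `z n → x` for the sets `S' n`. Dividing by `2 *
d` gives Clarke subgradients of the distance, to which Far applies because the tube is open; then
pass to the limit. -/
lemma le_norm_of_tendsto_farSet [CompleteSpace H] {S : Set H} {S' : ℕ → Set H}
    (hS' : ∀ n, (S' n).Nonempty) {α : ℝ} {ρ : ℝ≥0∞} (hfar : ∀ n, FarSet (S' n) α ρ)
    {η : ℕ → ℝ} (hη : Tendsto η atTop (𝓝 0))
    (hclose : ∀ n z, |Metric.infDist z (S' n) - Metric.infDist z S| ≤ η n)
    {x w : H} (hw : IsDistSqSupergradient S x w) (hx : 0 < Metric.infDist x S)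
    (hxρ : ENNReal.ofReal (Metric.infDist x S) < ρ) :
    2 * α * Metric.infDist x S ≤ ‖w‖ := by
  have hη0 : ∀ n, 0 ≤ η n := fun n => (abs_nonneg _).trans (hclose n x)
  choose z hzx hz using fun n => hw.exists_near (hS' n) (hη0 n) (hclose n)
  have hzlim : Tendsto z atTop (𝓝 x) := by
    rw [tendsto_iff_norm_sub_tendsto_zero]
    refine squeeze_zero (fun n => norm_nonneg _) hzx ?_
    have hc : Continuous fun r : ℝ => r + √(4 * r * Metric.infDist x S + 2 * r ^ 2) := by fun_prop
    simpa [Function.comp_def] using (hc.tendsto 0).comp hη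
  have hdlim : Tendsto (fun n => Metric.infDist (z n) (S' n)) atTop (𝓝 (Metric.infDist x S)) := by
    have h1 : Tendsto (fun n => Metric.infDist (z n) S) atTop (𝓝 (Metric.infDist x S)) :=
      ((Metric.continuous_infDist_pt S).tendsto x).comp hzlim
    have h2 : Tendsto (fun n => Metric.infDist (z n) (S' n) - Metric.infDist (z n) S) atTop
        (𝓝 0) := squeeze_zero_norm (fun n => hclose n (z n)) hη
    simpa using h2.add h1
  have hev : ∀ᶠ n in atTop, 2 * α * Metric.infDist (z n) (S' n) ≤ ‖w + (4 : ℝ) • (z n - x)‖ := by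
    have h2 : Tendsto (fun n => ENNReal.ofReal (Metric.infDist (z n) (S' n))) atTop
        (𝓝 (ENNReal.ofReal (Metric.infDist x S))) := ENNReal.tendsto_ofReal hdlim
    filter_upwards [hdlim.eventually_const_lt hx, h2.eventually_lt_const hxρ] with n hn hnρ
    have h3 := hfar n (z n) hn hnρ
    have h4 := h3.trans (Metric.infDist_le_dist_of_mem (mem_clarkeSubdiff_infDist 2 hn (hz n)))
    rw [dist_zero_left, norm_smul, Real.norm_eq_abs, abs_of_pos (by positivity),
      one_div_mul_eq_div, le_div_iff₀ (by positivity)] at h4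
    linarith
  have hl : Tendsto (fun n => ‖w + (4 : ℝ) • (z n - x)‖) atTop (𝓝 ‖w‖) := by
    have hc : Continuous fun y : H => ‖w + (4 : ℝ) • (y - x)‖ := by fun_prop
    simpa [Function.comp_def] using (hc.tendsto x).comp hzlim
  exact le_of_tendsto_of_tendsto (hdlim.const_mul (2 * α)) hl hev

/-- In a separable space, the exceptional set of times in `PositivelyFar` can be chosen
independently of the state. -/
lemma PositivelyFar.ae_forall_le_norm [CompleteSpace H] [TopologicalSpace.SeparableSpace H]
    {C : ℝ → H → Set H} {T : ℝ} {κ : ℝ → ℝ} {L : ℝ}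
    (hCne : ∀ t ∈ Icc 0 T, ∀ x, (C t x).Nonempty) (hC : TruncatedLipschitz C T κ L)
    {α : ℝ} {ρ : ℝ≥0∞} (hfar : PositivelyFar C T α ρ) :
    ∀ᵐ t ∂(volume.restrict (Icc 0 T)), ∀ y x w : H, IsDistSqSupergradient (C t y) x w →
      0 < Metric.infDist x (C t y) → ENNReal.ofReal (Metric.infDist x (C t y)) < ρ →
      2 * α * Metric.infDist x (C t y) ≤ ‖w‖ := by
  -- Countably many states cost one null set; other states follow by approximation, since at a fixed
  -- time `C` varies by at most `L * ‖v n - y‖`.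
  have h1 : ∀ᵐ t ∂(volume.restrict (Icc 0 T)), ∀ n : ℕ,
      FarSet (C t (TopologicalSpace.denseSeq H n)) α ρ :=
    ae_all_iff.2 fun n => hfar (TopologicalSpace.denseSeq H n)
  filter_upwards [h1, ae_restrict_mem measurableSet_Icc] with t ht htT y x w hw hx hxρ
  obtain ⟨v, hv, hvy⟩ := mem_closure_iff_seq_limit.1
    (TopologicalSpace.denseRange_denseSeq H y)
  choose k hk using hv
  refine le_norm_of_tendsto_farSet (S' := fun n => C t (v n)) (fun n => hCne t htT _)
    (fun n => hk n ▸ ht (k n)) (η := fun n => L * ‖v n - y‖) ?_ (fun n z => ?_) hw hx hxρ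
  · simpa using (tendsto_iff_norm_sub_tendsto_zero.1 hvy).const_mul L
  · simpa using (hC ‖z‖ (norm_nonneg z)).2 t htT t htT (v n) y z le_rfl

end Stability

/-! ### The differential inequality for the gap. -/

section Derivative

variable {H : Type*} [NormedAddCommGroup H] [InnerProductSpace ℝ H]

/-- Upper estimate of the derivative of the gap at a time where the trajectory leaves along a
supergradient of the squared distance. -/
lemma deriv_gap_le {A : H → H} {m M L k lam α : ℝ} (hm : 0 < m) (hL : 0 ≤ L)
    (hA₁ : StronglyMonotone A m) (hA₂ : LipschitzMap A M) {C : ℝ → H → Set H}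
    (hlam : 0 < lam) (hα : 0 ≤ α) {x : ℝ → H} {t φ' : ℝ} {v : H} (hx : HasDerivAt x v t)
    (hφ : HasDerivAt (gap A C x) φ' t)
    (hsup : IsDistSqSupergradient (C t (x t)) (A (x t)) ((-(2 * lam)) • v))
    (hpos : 0 < gap A C x t) (hlow : α * gap A C x t ≤ lam * ‖v‖)
    (hup : lam * ‖v‖ ≤ gap A C x t)
    (hloc : ∀ᶠ s in 𝓝[>] t, gap A C x s ≤
      Metric.infDist (A (x s)) (C t (x t)) + k * |s - t| + L * ‖x s - x t‖) :
    φ' ≤ k + (L - m * α ^ 2) / lam * gap A C x t := by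
  set φ := gap A C x t with hφdef
  set q : ℝ → H := slope x t with hq
  have hqlim : Tendsto q (𝓝[>] t) (𝓝 v) :=
    (hasDerivAt_iff_tendsto_slope.1 hx).mono_left (nhdsWithin_mono t fun s hs => ne_of_gt hs)
  have hφlim : Tendsto (slope (gap A C x) t) (𝓝[>] t) (𝓝 φ') :=
    (hasDerivAt_iff_tendsto_slope.1 hφ).mono_left (nhdsWithin_mono t fun s hs => ne_of_gt hs)
  have hlim : Tendsto (fun s => k + L * ‖q s‖ -
      lam / φ * (m * ‖q s‖ ^ 2 - M * ‖v - q s‖ * ‖q s‖) + (s - t) * (M ^ 2 * ‖q s‖ ^ 2) / (2 * φ))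
      (𝓝[>] t) (𝓝 (k + L * ‖v‖ - lam / φ * (m * ‖v‖ ^ 2))) := by
    have hst : Tendsto (fun s : ℝ => s) (𝓝[>] t) (𝓝 t) := tendsto_id.mono_left nhdsWithin_le_nhds
    have hc : Continuous fun p : ℝ × H => k + L * ‖p.2‖ -
        lam / φ * (m * ‖p.2‖ ^ 2 - M * ‖v - p.2‖ * ‖p.2‖) +
        (p.1 - t) * (M ^ 2 * ‖p.2‖ ^ 2) / (2 * φ) := by fun_prop
    have := (hc.tendsto (t, v)).comp (hst.prodMk_nhds hqlim)
    simpa [Function.comp_def] using this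
  have hle : ∀ᶠ s in 𝓝[>] t, slope (gap A C x) t s ≤ k + L * ‖q s‖ -
      lam / φ * (m * ‖q s‖ ^ 2 - M * ‖v - q s‖ * ‖q s‖) +
      (s - t) * (M ^ 2 * ‖q s‖ ^ 2) / (2 * φ) := by
    filter_upwards [hloc, self_mem_nhdsWithin] with s hs hst
    have hst : t < s := hst
    obtain ⟨h, hh, rfl⟩ : ∃ h : ℝ, 0 < h ∧ s = t + h := ⟨s - t, by linarith, by ring⟩
    have hxq : x (t + h) - x t = h • q (t + h) := by
      rw [hq, slope_def_module, add_sub_cancel_left, smul_smul, mul_inv_cancel₀ hh.ne', one_smul]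
    have hnx : ‖x (t + h) - x t‖ = h * ‖q (t + h)‖ := by
      rw [hxq, norm_smul, Real.norm_eq_abs, abs_of_pos hh]
    set y := q (t + h) with hy
    set D := A (x (t + h)) - A (x t) with hD
    have hDn : ‖D‖ ≤ M * (h * ‖y‖) := hnx ▸ hA₂ (x (t + h)) (x t)
    have hDi : m * h * ‖y‖ ^ 2 ≤ inner ℝ y D := by
      have h1 := hA₁ (x (t + h)) (x t)
      rw [hnx, hxq, inner_smul_right, ← hD, real_inner_comm] at h1
      have h2 : h * (m * h * ‖y‖ ^ 2) ≤ h * inner ℝ y D := by linarith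
      exact le_of_mul_le_mul_left h2 hh
    -- Strong monotonicity controls `D` against the difference quotient `y`; replacing `y` by `v`
    -- costs an error that vanishes in the limit.
    have hvD : m * h * ‖y‖ ^ 2 - ‖v - y‖ * (M * (h * ‖y‖)) ≤ inner ℝ v D := by
      have h1 : inner ℝ v D = inner ℝ y D + inner ℝ (v - y) D := by
        rw [← inner_add_left, add_sub_cancel]
      have h2 := neg_le_of_abs_le (abs_real_inner_le_norm (v - y) D)
      have h3 := mul_le_mul_of_nonneg_left hDn (norm_nonneg (v - y))
      linarith
    have hDsq : ‖D‖ ^ 2 ≤ (M * (h * ‖y‖)) ^ 2 := pow_le_pow_left₀ (norm_nonneg _) hDn 2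
    have h1 := hsup (A (x (t + h)))
    rw [← hD, inner_smul_left, add_assoc] at h1
    simp only [conj_trivial] at h1
    have h2 := le_add_of_sq_le hpos h1
    have h3 : (-(2 * lam) * inner ℝ v D + ‖D‖ ^ 2) / (2 * φ) ≤
        h * (-(lam / φ * (m * ‖y‖ ^ 2 - M * ‖v - y‖ * ‖y‖)) +
          h * (M ^ 2 * ‖y‖ ^ 2) / (2 * φ)) := by
      rw [div_le_iff₀ (by positivity)]
      have : h * (-(lam / φ * (m * ‖y‖ ^ 2 - M * ‖v - y‖ * ‖y‖)) +
          h * (M ^ 2 * ‖y‖ ^ 2) / (2 * φ)) * (2 * φ) =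
          -(2 * lam) * (m * h * ‖y‖ ^ 2 - ‖v - y‖ * (M * (h * ‖y‖))) + (M * (h * ‖y‖)) ^ 2 := by
        field_simp
      rw [this]
      nlinarith
    rw [add_sub_cancel_left, abs_of_pos hh, hnx] at hs
    rw [slope_def_field, add_sub_cancel_left, div_le_iff₀ hh]
    change Metric.infDist (A (x (t + h))) (C t (x t)) ≤ φ + _ at h2
    linarith
  refine (le_of_tendsto_of_tendsto hφlim hlim hle).trans ?_
  have h1 : L * ‖v‖ ≤ L / lam * φ := by
    rw [div_mul_eq_mul_div, le_div_iff₀ hlam]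
    nlinarith [mul_le_mul_of_nonneg_left hup hL]
  have h2 : m * α ^ 2 / lam * φ ≤ lam / φ * (m * ‖v‖ ^ 2) := by
    have h3 : (α * φ) ^ 2 ≤ (lam * ‖v‖) ^ 2 := pow_le_pow_left₀ (by positivity) hlow 2
    rw [div_mul_eq_mul_div, div_mul_eq_mul_div, div_le_div_iff₀ hlam hpos]
    nlinarith [mul_le_mul_of_nonneg_left h3 hm.le]
  rw [sub_div, sub_mul]
  linarith

end Derivative

/-! ### Absolutely continuous functions: mean value bound and barrier. -/

section AbsolutelyContinuous

lemma absolutelyContinuousOnInterval_of_dist_le {X Y : Type*} [PseudoMetricSpace X]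
    [PseudoMetricSpace Y] {f : ℝ → X} {g : ℝ → Y} {a b c k : ℝ}
    (hf : AbsolutelyContinuousOnInterval f a b)
    (hg : ∀ s ∈ uIcc a b, ∀ t ∈ uIcc a b, dist (g s) (g t) ≤ c * dist (f s) (f t) + k * dist s t) :
    AbsolutelyContinuousOnInterval g a b := by
  have hid : AbsolutelyContinuousOnInterval (fun s : ℝ => s) a b :=
    (LipschitzWith.id.lipschitzOnWith (s := uIcc a b)).absolutelyContinuousOnInterval
  have hlim := (Tendsto.const_mul c hf).add (Tendsto.const_mul k hid)
  rw [mul_zero, mul_zero, add_zero] at hlim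
  refine squeeze_zero' (Eventually.of_forall fun E => Finset.sum_nonneg fun i _ => dist_nonneg)
    ?_ hlim
  filter_upwards [mem_inf_of_right (mem_principal_self _)] with E hE
  rw [Finset.mul_sum, Finset.mul_sum, ← Finset.sum_add_distrib]
  exact Finset.sum_le_sum fun i hi => hg _ (hE.1 i hi).1 _ (hE.1 i hi).2

lemma le_of_ae_deriv_nonpos {f : ℝ → ℝ} {a b : ℝ} (hab : a ≤ b)
    (hf : AbsolutelyContinuousOnInterval f a b)
    (hd : ∀ᵐ t, t ∈ Ioc a b → deriv f t ≤ 0) : f b ≤ f a := by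
  have h1 := hf.integral_deriv_eq_sub
  have h2 : ∫ t in a..b, deriv f t ≤ 0 := by
    rw [intervalIntegral.integral_of_le hab]
    exact integral_nonpos_of_ae ((ae_restrict_iff' measurableSet_Ioc).2 hd)
  linarith

lemma norm_sub_le_of_ae_norm_deriv_le {H : Type*} [NormedAddCommGroup H] [InnerProductSpace ℝ H]
    {x : ℝ → H} {a b K : ℝ} (hab : a ≤ b) (hx : AbsolutelyContinuousOnInterval x a b)
    (hd : ∀ᵐ t, t ∈ Ioc a b → DifferentiableAt ℝ x t ∧ ‖deriv x t‖ ≤ K) :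
    ‖x b - x a‖ ≤ K * (b - a) := by
  rcases eq_or_ne (x b - x a) 0 with h0 | h0
  · rw [h0, norm_zero]
    rcases hab.eq_or_lt with rfl | hlt
    · simp
    -- In this case the claim is `0 ≤ K * (b - a)`; the sign of `K` comes from one time at which the
    -- bound holds.
    have hne : (volume.restrict (Ioc a b)) ≠ 0 := by
      rw [Ne, Measure.restrict_eq_zero, Real.volume_Ioc]
      simpa using hlt
    have : (ae (volume.restrict (Ioc a b))).NeBot := ae_neBot.2 hne
    obtain ⟨t, ht⟩ := ((ae_restrict_iff' measurableSet_Ioc).2 hd).exists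
    exact mul_nonneg ((norm_nonneg _).trans ht.2) (by linarith)
  set v := x b - x a
  have hv : 0 < ‖v‖ := norm_pos_iff.2 h0
  -- Pairing with `v = x b - x a` reduces the vector-valued bound to the real fundamental theorem of
  -- calculus.
  have hac : AbsolutelyContinuousOnInterval (fun t => inner ℝ v (x t) - K * ‖v‖ * t) a b := by
    refine absolutelyContinuousOnInterval_of_dist_le (c := ‖v‖) (k := |K * ‖v‖|) hx
      fun s _ t _ => ?_
    rw [dist_eq_norm, dist_eq_norm, dist_eq_norm, Real.norm_eq_abs, Real.norm_eq_abs]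
    have h1 : inner ℝ v (x s) - K * ‖v‖ * s - (inner ℝ v (x t) - K * ‖v‖ * t) =
        inner ℝ v (x s - x t) - K * ‖v‖ * (s - t) := by rw [inner_sub_right]; ring
    rw [h1, ← abs_mul]
    exact (abs_sub _ _).trans (by gcongr; exact abs_real_inner_le_norm _ _)
  have h1 := le_of_ae_deriv_nonpos hab hac ?_
  · have h2 : ‖v‖ * ‖v‖ ≤ ‖v‖ * (K * (b - a)) := by
      have h3 : inner ℝ v (x b) - inner ℝ v (x a) = ‖v‖ * ‖v‖ := by
        rw [← inner_sub_right]; exact real_inner_self_eq_norm_mul_norm v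
      linarith
    exact le_of_mul_le_mul_left h2 hv
  · filter_upwards [hd] with t ht htab
    obtain ⟨hdiff, hK⟩ := ht htab
    have h3 : HasDerivAt (fun t => inner ℝ v (x t) - K * ‖v‖ * t)
        (inner ℝ v (deriv x t) - K * ‖v‖ * 1) t := by
      refine HasDerivAt.sub ?_ ((hasDerivAt_id t).const_mul _)
      exact ((innerSL ℝ v).hasFDerivAt.comp_hasDerivAt t hdiff.hasDerivAt)
    rw [h3.deriv]
    have h4 := real_inner_le_norm v (deriv x t)
    nlinarith [mul_le_mul_of_nonneg_left hK hv.le]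

lemma exists_first_time {f : ℝ → ℝ} {a b B : ℝ} (hab : a ≤ b) (hf : ContinuousOn f (Icc a b))
    (ha : f a ≤ B) (hb : B ≤ f b) : ∃ c ∈ Icc a b, f c = B ∧ ∀ t ∈ Icc a c, f t ≤ B := by
  obtain ⟨s, hs, hsB⟩ := intermediate_value_Icc hab hf ⟨ha, hb⟩
  have hcomp : IsCompact (Icc a b ∩ f ⁻¹' {B}) :=
    isCompact_Icc.of_isClosed_subset (hf.preimage_isClosed_of_isClosed isClosed_Icc
      isClosed_singleton) inter_subset_left
  obtain ⟨c, ⟨hc, hcB⟩, hleast⟩ := hcomp.exists_isLeast ⟨s, hs, hsB⟩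
  refine ⟨c, hc, hcB, fun t ht => ?_⟩
  by_contra! hlt
  have hsub : Icc a t ⊆ Icc a b := Icc_subset_Icc_right (ht.2.trans hc.2)
  obtain ⟨r, hr, hrB⟩ := intermediate_value_Icc ht.1 (hf.mono hsub) ⟨ha, hlt.le⟩
  have h1 : c ≤ r := hleast ⟨hsub hr, hrB⟩
  have h2 : r = t := le_antisymm hr.2 (ht.2.trans h1)
  rw [h2] at hrB
  linarith

lemma exists_last_time {f : ℝ → ℝ} {a b B : ℝ} (hab : a ≤ b) (hf : ContinuousOn f (Icc a b))
    (ha : f a ≤ B) : ∃ c ∈ Icc a b, f c ≤ B ∧ ∀ t ∈ Ioc c b, B < f t := by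
  have hcomp : IsCompact (Icc a b ∩ f ⁻¹' Iic B) :=
    isCompact_Icc.of_isClosed_subset (hf.preimage_isClosed_of_isClosed isClosed_Icc
      isClosed_Iic) inter_subset_left
  obtain ⟨c, ⟨hc, hcB⟩, hgreat⟩ := hcomp.exists_isGreatest ⟨a, left_mem_Icc.2 hab, ha⟩
  refine ⟨c, hc, hcB, fun t ht => ?_⟩
  by_contra! hlt
  exact absurd (hgreat ⟨⟨hc.1.trans ht.1.le, ht.2⟩, hlt⟩) (not_le.2 ht.1)

/-- Barrier principle: an absolutely continuous function starting below `B` which does not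
increase while its values lie in `(B, B']` remains below `B`. -/
lemma le_of_ae_deriv_nonpos_of_barrier {f : ℝ → ℝ} {a b B B' : ℝ}
    (hf : AbsolutelyContinuousOnInterval f a b) (ha : f a ≤ B) (hB : B < B')
    (hd : ∀ᵐ t, t ∈ Icc a b → B < f t → f t ≤ B' → deriv f t ≤ 0) :
    ∀ t ∈ Icc a b, f t ≤ B := by
  intro s hs
  by_contra! hlt
  have hcont : ContinuousOn f (Icc a b) := by
    rw [← uIcc_of_le (hs.1.trans hs.2)]; exact hf.continuousOn
  obtain ⟨c, hc, hcB, hcle⟩ := exists_first_time (B := min (f s) B') hs.1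
    (hcont.mono (Icc_subset_Icc_right hs.2)) (ha.trans (le_min hlt.le hB.le)) (min_le_left _ _)
  have hcb : c ≤ b := hc.2.trans hs.2
  -- On `Ioc r c` the values lie in `(B, B']`, so `f c ≤ f r ≤ B`, contradicting `f c = min (f s)
  -- B'`.
  obtain ⟨r, hr, hrB, hrlt⟩ := exists_last_time hc.1 (hcont.mono (Icc_subset_Icc_right hcb)) ha
  have hac : AbsolutelyContinuousOnInterval f r c := by
    refine hf.mono ?_
    rw [uIcc_of_le hr.2, uIcc_of_le (hs.1.trans hs.2)]
    exact Icc_subset_Icc hr.1 hcb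
  have h1 := le_of_ae_deriv_nonpos hr.2 hac ?_
  · have h2 : B < min (f s) B' := lt_min hlt hB
    linarith
  · filter_upwards [hd] with t ht htm
    exact ht ⟨hr.1.trans htm.1.le, htm.2.trans hcb⟩ (hrlt t htm)
      ((hcle t ⟨hr.1.trans htm.1.le, htm.2⟩).trans (min_le_right _ _))

end AbsolutelyContinuous

/-! ### Regularity of the gap, the range of `λ`, and the exit time. -/

section Gap

variable {H : Type*} [NormedAddCommGroup H]

lemma gap_le_infDist_add {A : H → H} {C : ℝ → H → Set H} {T : ℝ} {κ : ℝ → ℝ} {L r : ℝ}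
    (hC : TruncatedLipschitz C T κ L) {x : ℝ → H} {s t : ℝ} (hs : s ∈ Icc 0 T)
    (ht : t ∈ Icc 0 T) (hr : ‖A (x s)‖ ≤ r) :
    gap A C x s ≤
      Metric.infDist (A (x s)) (C t (x t)) + κ r * |s - t| + L * ‖x s - x t‖ := by
  have h1 := (abs_le.1 ((hC r ((norm_nonneg _).trans hr)).2 t ht s hs (x s) (x t) _ hr)).2
  rw [gap]
  linarith

lemma dist_gap_le {A : H → H} {C : ℝ → H → Set H} {T : ℝ} {κ : ℝ → ℝ} {L M r : ℝ}
    (hA : LipschitzMap A M) (hC : TruncatedLipschitz C T κ L) {x : ℝ → H} {s t : ℝ}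
    (hs : s ∈ Icc 0 T) (ht : t ∈ Icc 0 T) (hrs : ‖A (x s)‖ ≤ r) (hrt : ‖A (x t)‖ ≤ r) :
    dist (gap A C x s) (gap A C x t) ≤ (M + L) * dist (x s) (x t) + κ r * dist s t := by
  have key : ∀ s ∈ Icc 0 T, ∀ t ∈ Icc 0 T, ‖A (x s)‖ ≤ r →
      gap A C x s - gap A C x t ≤ (M + L) * dist (x s) (x t) + κ r * dist s t := by
    intro s hs t ht hr
    have h1 := gap_le_infDist_add hC hs ht hr
    have h2 : Metric.infDist (A (x s)) (C t (x t)) ≤ gap A C x t + dist (A (x s)) (A (x t)) :=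
      Metric.infDist_le_infDist_add_dist
    have h3 := hA (x s) (x t)
    rw [dist_eq_norm] at h2
    rw [dist_eq_norm, dist_eq_norm, Real.norm_eq_abs]
    linarith
  rw [dist_eq_norm (gap A C x s), Real.norm_eq_abs, abs_sub_le_iff]
  refine ⟨key s hs t ht hrs, ?_⟩
  rw [dist_comm (x s), dist_comm s]
  exact key t ht s hs hrt

/-- The smallness condition on `λ` says that the level `κ̃λ/(mα² - L)` lies inside the tube. For `k
= 0` or `ρ = ⊤` the right-hand side of `h` is `⊤`, so all `l` are allowed. -/
lemma ofReal_div_mul_lt {a k l : ℝ} {ρ : ℝ≥0∞} (ha : 0 < a) (hk : 0 ≤ k) (hρ : 0 < ρ)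
    (h : ENNReal.ofReal l < ENNReal.ofReal a / ENNReal.ofReal k * ρ) :
    ENNReal.ofReal (k * l / a) < ρ := by
  rcases hk.eq_or_lt with rfl | hk
  · simpa using hρ
  rcases eq_or_ne ρ ⊤ with rfl | hρt
  · exact ENNReal.ofReal_lt_top
  lift ρ to ℝ≥0 using hρt with p
  rw [← ENNReal.ofReal_coe_nnreal, ← ENNReal.ofReal_div_of_pos hk,
    ← ENNReal.ofReal_mul (by positivity)] at h
  have hp : (0 : ℝ) < p := by exact_mod_cast hρ
  rw [ENNReal.ofReal_lt_ofReal_iff (by positivity)] at h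
  rw [← ENNReal.ofReal_coe_nnreal, ENNReal.ofReal_lt_ofReal_iff hp, div_lt_iff₀ ha]
  have : k * (a / k * p) = p * a := by field_simp
  nlinarith [mul_lt_mul_of_pos_left h hk]

/-- A trajectory moving at speed at most `K` as long as it stays in the ball of radius `R` cannot
leave this ball before time `R / (K + 1)`. -/
lemma norm_sub_le_of_speed_le {x : ℝ → H} {τ R K : ℝ} (hR : 0 < R) (hK : 0 ≤ K)
    (hτ : τ ≤ R / (K + 1)) (hx : ContinuousOn x (Icc 0 τ))
    (hspeed : ∀ σ ∈ Icc 0 τ, (∀ t ∈ Icc 0 σ, ‖x t - x 0‖ ≤ R) → ‖x σ - x 0‖ ≤ K * σ) :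
    ∀ t ∈ Icc 0 τ, ‖x t - x 0‖ ≤ R := by
  intro t ht
  by_contra! hlt
  have hcont : ContinuousOn (fun s => ‖x s - x 0‖) (Icc 0 t) :=
    ((hx.mono (Icc_subset_Icc_right ht.2)).sub continuousOn_const).norm
  obtain ⟨c, hc, hcR, hcle⟩ := exists_first_time (f := fun s => ‖x s - x 0‖) ht.1 hcont
    (by simpa using hR.le) hlt.le
  have h1 := hspeed c ⟨hc.1, hc.2.trans ht.2⟩ hcle
  -- The exit time `c` satisfies `R ≤ K * c`; the extra 1 makes this contradictory for `c > 0` and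
  -- avoids dividing by 0.
  have h2 : c * (K + 1) ≤ R := (le_div_iff₀ (by positivity)).1 ((hc.2.trans ht.2).trans hτ)
  have h3 : 0 < c := by
    refine lt_of_le_of_ne hc.1 fun h0 => ?_
    rw [← h0] at hcR
    simp only [sub_self, norm_zero] at hcR
    linarith
  nlinarith

end Gap

/-! ### A priori estimates for the regularized solutions. -/

section Estimates

variable {H : Type*} [NormedAddCommGroup H] [InnerProductSpace ℝ H]

lemma IsRegularizedSolution.ae_norm_deriv_le {A : H → H} {C : ℝ → H → Set H} {T : ℝ}
    (hCne : ∀ t ∈ Icc 0 T, ∀ x, (C t x).Nonempty) {x₀ : H} {lam : ℝ} (hlam : 0 < lam)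
    {x : ℝ → H} (hx : IsRegularizedSolution A C T x₀ lam x) :
    ∀ᵐ t, t ∈ Icc 0 T → DifferentiableAt ℝ x t ∧
      IsDistSqSupergradient (C t (x t)) (A (x t)) ((-(2 * lam)) • deriv x t) ∧
      lam * ‖deriv x t‖ ≤ gap A C x t := by
  have h1 := (ae_restrict_iff' measurableSet_Icc).1 hx.inclusion
  filter_upwards [h1] with t ht htT
  obtain ⟨hd, w, hw, hwx⟩ := ht htT
  have hsup := isDistSqSupergradient_of_mem_clarkeSubdiff (hCne t htT (x t)) hw
  have hweq : w = (-(2 * lam)) • deriv x t := by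
    have h2 : (2 * lam) • ((1 / (2 * lam)) • w) = w := by
      rw [smul_smul, mul_one_div_cancel (by positivity), one_smul]
    rw [← h2]
    change (2 * lam) • ((fun u => (1 / (2 * lam)) • u) w) = _
    rw [hwx, smul_neg, neg_smul]
  refine ⟨hd, hweq ▸ hsup, ?_⟩
  have h3 := hsup.norm_le
  rw [hweq, norm_smul, norm_neg, Real.norm_eq_abs, abs_of_pos (by positivity)] at h3
  rw [gap]
  linarith

/-- The a priori estimates on an interval on which the trajectory stays in the ball of radius `R`
around its initial point. -/
lemma IsRegularizedSolution.estimates [CompleteSpace H] [TopologicalSpace.SeparableSpace H]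
    {T m M : ℝ} {A : H → H} (hm : 0 < m) (hM : 0 < M)
    (hA₁ : StronglyMonotone A m) (hA₂ : LipschitzMap A M) {C : ℝ → H → Set H}
    (hCne : ∀ t ∈ Icc 0 T, ∀ x, (C t x).Nonempty) {κ : ℝ → ℝ} {L : ℝ} (hL : 0 ≤ L)
    (hC : TruncatedLipschitz C T κ L) {x₀ : H} (hx₀ : A x₀ ∈ C 0 x₀) {α : ℝ} {ρ : ℝ≥0∞}
    (hα : 0 ≤ α) (hαL : L < m * α ^ 2) (hρ : 0 < ρ) (hfar : PositivelyFar C T α ρ) {R lam : ℝ}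
    (hlam : 0 < lam)
    (hlamρ : ENNReal.ofReal lam <
      ENNReal.ofReal (m * α ^ 2 - L) / ENNReal.ofReal (κ (‖A x₀‖ + M * R)) * ρ)
    {x : ℝ → H} (hx : IsRegularizedSolution A C T x₀ lam x) {τ : ℝ} (hτ : 0 ≤ τ) (hτT : τ ≤ T)
    (hball : ∀ t ∈ Icc 0 τ, ‖x t - x₀‖ ≤ R) :
    (∀ᵐ t ∂(volume.restrict (Icc 0 τ)), DifferentiableAt ℝ (gap A C x) t ∧
      deriv (gap A C x) t ≤
        κ (‖A x₀‖ + M * R) + (L - m * α ^ 2) / lam * gap A C x t) ∧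
    (∀ t ∈ Icc 0 τ, gap A C x t ≤ κ (‖A x₀‖ + M * R) * lam / (m * α ^ 2 - L)) ∧
    ∀ s ∈ Icc 0 τ, ∀ t ∈ Icc 0 τ, s ≤ t →
      ‖x t - x s‖ ≤ κ (‖A x₀‖ + M * R) / (m * α ^ 2 - L) * (t - s) := by
  set r := ‖A x₀‖ + M * R
  set a := m * α ^ 2 - L
  have ha : 0 < a := by simp only [a]; linarith
  have hr : ∀ t ∈ Icc 0 τ, ‖A (x t)‖ ≤ r := by
    intro t ht
    have h1 := hA₂ (x t) x₀
    have h2 : ‖A (x t)‖ ≤ ‖A x₀‖ + ‖A (x t) - A x₀‖ := norm_le_norm_add_norm_sub' _ _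
    have h3 := mul_le_mul_of_nonneg_left (hball t ht) hM.le
    simp only [r]
    linarith
  have hr0 : 0 ≤ r := (norm_nonneg _).trans (hr 0 ⟨le_rfl, hτ⟩)
  have hκ : 0 ≤ κ r := (hC r hr0).1
  have hsub : Icc 0 τ ⊆ Icc 0 T := Icc_subset_Icc_right hτT
  have hxac : AbsolutelyContinuousOnInterval x 0 τ := by
    refine hx.absCont.mono ?_
    rwa [uIcc_of_le hτ, uIcc_of_le (hτ.trans hτT)]
  have hφac : AbsolutelyContinuousOnInterval (gap A C x) 0 τ := by
    refine absolutelyContinuousOnInterval_of_dist_le (c := M + L) (k := κ r) hxac fun s hs t ht => ?_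
    rw [uIcc_of_le hτ] at hs ht
    exact dist_gap_le hA₂ hC (hsub hs) (hsub ht) (hr s hs) (hr t ht)
  have hφ0 : gap A C x 0 = 0 := by
    rw [gap, hx.initial]; exact Metric.infDist_zero_of_mem hx₀
  -- The inequality is conditional on lying in the tube; the barrier bound `hb` removes this
  -- condition afterwards.
  have hpt : ∀ᵐ t, t ∈ Icc 0 τ → DifferentiableAt ℝ (gap A C x) t ∧
      (ENNReal.ofReal (gap A C x t) < ρ →
        deriv (gap A C x) t ≤ κ r + (L - m * α ^ 2) / lam * gap A C x t) := by
    have h1 : ∀ᵐ t : ℝ, t ≠ 0 := by simp [ae_iff, measure_singleton]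
    have h2 : ∀ᵐ t : ℝ, t ≠ τ := by simp [ae_iff, measure_singleton]
    filter_upwards [hφac.ae_differentiableAt, hx.ae_norm_deriv_le hCne hlam, h1, h2,
      (ae_restrict_iff' measurableSet_Icc).1 (hfar.ae_forall_le_norm hCne hC)]
      with t htφ htx ht0 htτ htfar ht
    rw [uIcc_of_le hτ] at htφ
    have hφd := htφ ht
    obtain ⟨hxd, hsup, hup⟩ := htx (hsub ht)
    have htI : Icc 0 τ ∈ 𝓝 t :=
      Icc_mem_nhds (lt_of_le_of_ne ht.1 (Ne.symm ht0)) (lt_of_le_of_ne ht.2 htτ)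
    refine ⟨hφd, fun hφρ => ?_⟩
    have hnn : 0 ≤ gap A C x t := Metric.infDist_nonneg
    rcases hnn.eq_or_lt with h0 | hpos
    · have hmin : IsLocalMin (gap A C x) t :=
        Eventually.of_forall fun s => by rw [← h0]; exact Metric.infDist_nonneg
      rw [hmin.deriv_eq_zero, ← h0, mul_zero, add_zero]
      exact hκ
    · have hlow := htfar (hsub ht) (x t) (A (x t)) _ hsup hpos hφρ
      rw [norm_smul, norm_neg, Real.norm_eq_abs, abs_of_pos (by positivity)] at hlow
      change 2 * α * gap A C x t ≤ _ at hlow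
      refine deriv_gap_le hm hL hA₁ hA₂ hlam hα hxd.hasDerivAt hφd.hasDerivAt hsup hpos
        (by linarith) hup ?_
      filter_upwards [nhdsWithin_le_nhds htI] with s hs
      exact gap_le_infDist_add hC (hsub hs) (hsub ht) (hr s hs)
  have hlt := ofReal_div_mul_lt ha hκ hρ hlamρ
  have hb : ∀ t ∈ Icc 0 τ, gap A C x t ≤ κ r * lam / a := by
    -- An intermediate level `b` below `ρ`: between `κ r * lam / a` and `b` the differential
    -- inequality applies and its right-hand side is nonpositive.
    obtain ⟨b, hb1, hb2⟩ := ENNReal.lt_iff_exists_nnreal_btwn.1 hlt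
    rw [← ENNReal.ofReal_coe_nnreal] at hb1 hb2
    have hBb : κ r * lam / a < b := (ENNReal.ofReal_lt_ofReal_iff').1 hb1 |>.1
    refine le_of_ae_deriv_nonpos_of_barrier hφac (by rw [hφ0]; positivity) hBb ?_
    filter_upwards [hpt] with t ht htI hlo hhi
    refine ((ht htI).2 ((ENNReal.ofReal_le_ofReal hhi).trans_lt hb2)).trans ?_
    have h1 : κ r * lam < gap A C x t * a := (div_lt_iff₀ ha).1 hlo
    have h2 : (L - m * α ^ 2) / lam * gap A C x t = -(gap A C x t * a / lam) := by
      simp only [a]; ring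
    have h3 : κ r ≤ gap A C x t * a / lam := (le_div_iff₀ hlam).2 h1.le
    linarith
  refine ⟨(ae_restrict_iff' measurableSet_Icc).2 ?_, hb, fun s hs t ht hst => ?_⟩
  · filter_upwards [hpt] with t ht htI
    exact ⟨(ht htI).1, (ht htI).2 ((ENNReal.ofReal_le_ofReal (hb t htI)).trans_lt hlt)⟩
  · have hIcc : Icc s t ⊆ Icc 0 τ := Icc_subset_Icc hs.1 ht.2
    refine norm_sub_le_of_ae_norm_deriv_le hst (hxac.mono ?_) ?_
    · rwa [uIcc_of_le hst, uIcc_of_le hτ]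
    · filter_upwards [hx.ae_norm_deriv_le hCne hlam] with q hq hqI
      have hq' := hIcc (Ioc_subset_Icc_self hqI)
      obtain ⟨hd, -, hup⟩ := hq (hsub hq')
      refine ⟨hd, ?_⟩
      have h1 := hup.trans (hb q hq')
      rw [le_div_iff₀ ha] at h1 ⊢
      exact le_of_mul_le_mul_left (by linarith) hlam

end Estimates

end Sweeping

theorem mainTheorem3 {H : Type*} [NormedAddCommGroup H] [InnerProductSpace ℝ H] [CompleteSpace H]
    [TopologicalSpace.SeparableSpace H]
    (T : ℝ) (hT : 0 < T)
    (A : H → H) (m M : ℝ) (hm : 0 < m) (hM : 0 < M)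
    (hA₁ : Sweeping.StronglyMonotone A m) (hA₂ : Sweeping.LipschitzMap A M)
    (C : ℝ → H → Set H)
    (hCne : ∀ t ∈ Set.Icc 0 T, ∀ x, (C t x).Nonempty)
    (hCcl : ∀ t ∈ Set.Icc 0 T, ∀ x, IsClosed (C t x))
    (κ : ℝ → ℝ) (L : ℝ) (hL₀ : 0 ≤ L) (hLm : L < m)
    (hC₁ : Sweeping.TruncatedLipschitz C T κ L)
    (hC₃ : Sweeping.EquiUniformlySubsmooth C T)
    (hC₄ : Sweeping.CompactnessCondition Sweeping.kuratowskiMeasure A C T ∨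
      Sweeping.CompactnessCondition Sweeping.hausdorffMeasure A C T)
    (x₀ : H) (hx₀ : A x₀ ∈ C 0 x₀) :
    (∀ α : ℝ, √(L / m) < α → α < 1 → ∃ ρ : ℝ≥0∞, 0 < ρ ∧ Sweeping.PositivelyFar C T α ρ) ∧
    ∀ (α : ℝ) (ρ : ℝ≥0∞), √(L / m) < α → α ≤ 1 → 0 < ρ → Sweeping.PositivelyFar C T α ρ →
      ∀ R : ℝ, 0 < R → ∃ τ : ℝ, 0 < τ ∧ τ ≤ T ∧
        ∀ lam : ℝ, 0 < lam →
          ENNReal.ofReal lam <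
            ENNReal.ofReal (m * α ^ 2 - L) / ENNReal.ofReal (κ (‖A x₀‖ + M * R)) * ρ →
          ∀ x : ℝ → H, Sweeping.IsRegularizedSolution A C T x₀ lam x →
            (∀ᵐ t ∂(volume.restrict (Set.Icc 0 τ)),
              DifferentiableAt ℝ (Sweeping.gap A C x) t ∧
              deriv (Sweeping.gap A C x) t ≤
                κ (‖A x₀‖ + M * R) + (L - m * α ^ 2) / lam * Sweeping.gap A C x t) ∧
            (∀ t ∈ Set.Icc 0 τ,
              Sweeping.gap A C x t ≤ κ (‖A x₀‖ + M * R) * lam / (m * α ^ 2 - L)) ∧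
            LipschitzOnWith (Real.toNNReal (κ (‖A x₀‖ + M * R) / (m * α ^ 2 - L))) x
              (Set.Icc 0 τ) := by
  refine ⟨fun α _ hα => Sweeping.exists_positivelyFar hCne hCcl hC₃ hα, ?_⟩
  intro α ρ hαL _ hρ hfar R hR
  have hα : 0 ≤ α := (Real.sqrt_nonneg _).trans hαL.le
  have hLα : L < m * α ^ 2 := by
    have h1 : L / m < α ^ 2 := (Real.sqrt_lt' ((Real.sqrt_nonneg _).trans_lt hαL)).1 hαL
    rw [div_lt_iff₀ hm] at h1
    linarith
  have hκ : 0 ≤ κ (‖A x₀‖ + M * R) := (hC₁ _ (by positivity)).1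
  set K := κ (‖A x₀‖ + M * R) / (m * α ^ 2 - L)
  have hK : 0 ≤ K := div_nonneg hκ (by linarith)
  -- The speed bound `K` does not involve `λ`, so neither does this time.
  refine ⟨min T (R / (K + 1)), lt_min hT (by positivity), min_le_left _ _, ?_⟩
  intro lam hlam hlamρ x hx
  have hτ : 0 ≤ min T (R / (K + 1)) := le_min hT.le (by positivity)
  -- The estimates are kept available for every `σ`: they hold while the trajectory stays in the
  -- ball, and their Lipschitz bound prevents it from leaving.
  have hest := fun σ (hσ : σ ∈ Set.Icc 0 (min T (R / (K + 1)))) =>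
    hx.estimates hm hM hA₁ hA₂ hCne hL₀ hC₁ hx₀ hα hLα hρ hfar hlam hlamρ hσ.1
      (hσ.2.trans (min_le_left _ _))
  have hcont : ContinuousOn x (Set.Icc 0 (min T (R / (K + 1)))) := by
    have h1 := hx.absCont.continuousOn
    rw [Set.uIcc_of_le hT.le] at h1
    exact h1.mono (Set.Icc_subset_Icc_right (min_le_left _ _))
  have hball := Sweeping.norm_sub_le_of_speed_le hR hK (min_le_right _ _) hcont
    fun σ hσ hσR => by
      have h1 := (hest σ hσ (by rwa [hx.initial] at hσR)).2.2 0 ⟨le_rfl, hσ.1⟩ σ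
        ⟨hσ.1, le_rfl⟩ hσ.1
      rwa [sub_zero] at h1
  rw [hx.initial] at hball
  obtain ⟨h1, h2, h3⟩ := hest _ ⟨hτ, le_rfl⟩ hball
  refine ⟨h1, h2, LipschitzOnWith.of_dist_le_mul fun s hs t ht => ?_⟩
  rw [Real.coe_toNNReal _ hK, dist_eq_norm, Real.dist_eq]
  rcases le_total s t with hst | hst
  · rw [norm_sub_rev, abs_sub_comm, abs_of_nonneg (sub_nonneg.2 hst)]
    exact h3 s hs t ht hst
  · rw [abs_of_nonneg (sub_nonneg.2 hst)]
    exact h3 t ht s hs hst
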